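/- Let $\mathbb K$ be an algebraically closed field of characteristic $0$. Let $\bar{\mathcal A}=\bar{\mathcal A}_{-1}(2)$ be the 2-rank Taft Hopf algebra at $q=-1$: the $\mathbb K$-algebra generated by $g,h,x,y$ with relations $gh=hg$, $g^2=h^2=1$, $gx=-xg$, $gy=-yg$, $hx=-xh$, $hy=-yh$, $x^2=y^2=0$, $xy=-yx$, and with comultiplication $\Delta(g)=g\otimes g$, $\Delta(h)=h\otimes h$, $\Delta(x)=x\otimes 1+g\otimes x$, $\Delta(y)=y\otimes 1+h\otimes y$. For left $\bar{\mathcal A}$-modules $M,N$, the space $M\otimes N=M\otimes_{\mathbb K}N$ is an $\bar{\mathcal A}$-module through $\Delta$. Let $S=S(-,-)$ be the one-dimensional module on which $g,h$ act by $-1$ and $x,y$ act by $0$. Let $P=\bar{\mathcal A}\cdot\tfrac14(1+g+h+gh)$ and $P_-=\bar{\mathcal A}\cdot\tfrac14(1-g-h+gh)$; these are the projective covers of the trivial module and of $S$. For $r\ge 1$ and $\eta\in\mathbb K^\times$ let $M(r),W(r),N(r),N'(r),C(r,\eta)$ be the modules with a basis consisting of vectors $u_i$ and $v_i$, on which $g$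 and $h$ both act by $1$ on every $u_i$ and by $-1$ on every $v_i$, on which $x$ and $y$ kill every $v_i$, and on which: * $M(r)$, with basis $u_1,\dots,u_r,v_1,\dots,v_{r+1}$: $xu_i=v_i$, $yu_i=v_{i+1}$; * $W(r)$, with basis $u_1,\dots,u_{r+1},v_1,\dots,v_r$: $xu_i=v_i$, $yu_i=v_{i-1}$, where $v_0=v_{r+1}=0$; * $N(r)$, with basis $u_1,\dots,u_r,v_1,\dots,v_r$: $xu_i=v_i$, $yu_i=v_{i-1}$, where $v_0=0$; * $N'(r)$, with basis $u_1,\dots,u_r,v_1,\dots,v_r$: $xu_i=v_{i-1}$, $yu_i=v_i$, where $v_0=0$; * $C(r,\eta)$, with basis $u_1,\dots,u_r,v_1,\dots,v_r$: $xu_i=v_i$, $yu_i=\eta v_i+v_{i-1}$, where $v_0=0$. For $X$ among these five families write $X_-=X\otimes S$. **Theorem.** For all integers $r,s\ge1$ and all $\eta,\gamma\in\mathbb K^\times$ there are isomorphisms of $\bar{\mathcal A}$-modules: 1. $P\otimes P\cong P^{\oplus2}\oplus P_-^{\oplus2}$. 2. $M(r)\otimes P\cong P^{\oplus r}\oplus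 P_-^{\oplus (r+1)}$ and $W(r)\otimes P\cong P^{\oplus (r+1)}\oplus P_-^{\oplus r}$. 3. $C(r,\eta)\otimes P\cong N(r)\otimes P\cong N'(r)\otimes P\cong P^{\oplus r}\oplus P_-^{\oplus r}$. 4. $M(r)\otimes M(s)\cong P^{\oplus rs}\oplus M(r+s)_-$. 5. $W(r)\otimes W(s)\cong P^{\oplus rs}\oplus W(r+s)$. 6. $M(r)\otimes W(s)\cong P^{\oplus r(s+1)}\oplus W(s-r)_-$ if $r<s$; $\cong P^{\oplus r(r+1)}\oplus S$ if $r=s$; $\cong P^{\oplus (r+1)s}\oplus M(r-s)$ if $r>s$. 7. $M(r)\otimes C(s,\eta)\cong P^{\oplus rs}\oplus C(s,\eta)_-$. 8. $W(r)\otimes C(s,\eta)\cong P^{\oplus rs}\oplus C(s,\eta)$. 9. $M(r)\otimes N(s)\cong P^{\oplus rs}\oplus N(s)_-$ and $M(r)\otimes N'(s)\cong P^{\oplus rs}\oplus N'(s)_-$. 10. $W(r)\otimes N(s)\cong P^{\oplus rs}\oplus N(s)$ and $W(r)\otimes N'(s)\cong P^{\oplus rs}\oplus N'(s)$. 11. With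 $m=\min\{r,s\}$: $C(r,\eta)\otimes C(s,\gamma)\cong P^{\oplus rs}$ if $\eta\ne\gamma$, and $C(r,\eta)\otimes C(s,\gamma)\cong P^{\oplus(rs-m)}\oplus C(m,\eta)\oplus C(m,\eta)_-$ if $\eta=\gamma$. 12. $N(r)\otimes N(s)\cong P^{\oplus(rs-m)}\oplus N(m)\oplus N(m)_-$, with $m=\min\{r,s\}$. 13. $N'(r)\otimes N'(s)\cong P^{\oplus(rs-m)}\oplus N'(m)\oplus N'(m)_-$, with $m=\min\{r,s\}$. 14. $N(r)\otimes N'(s)\cong C(r,\eta)\otimes N(s)\cong C(r,\eta)\otimes N'(s)\cong P^{\oplus rs}$. -/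

import Mathlib

open scoped TensorProduct

noncomputable section

namespace TaftTwo

universe u

/-! ### The algebra -/

/-- The defining relations of the 2-rank Taft algebra at `q = -1`, for four elements of a
`K`-algebra. -/
structure Relations {B : Type*} [Ring B] (g h x y : B) : Prop where
  gh : g * h = h * g
  gg : g * g = 1
  hh : h * h = 1
  gx : g * x = -(x * g)
  gy : g * y = -(y * g)
  hx : h * x = -(x * h)
  hy : h * y = -(y * h)
  xx : x * x = 0
  yy : y * y = 0
  xy : x * y = -(y * x)

/-- The four generators. -/
inductive Gen : Type
  | g
  | h
  | x
  | y

/-- The value on each generator of the map sending the generators to `g, h, x, y`. -/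
def Gen.val {B : Type*} (g h x y : B) : Gen → B
  | Gen.g => g
  | Gen.h => h
  | Gen.x => x
  | Gen.y => y

/-- The defining relations inside the free algebra on the generators. -/
inductive Rel (K : Type u) [Field K] : FreeAlgebra K Gen → FreeAlgebra K Gen → Prop
  | gh : Rel K (FreeAlgebra.ι K Gen.g * FreeAlgebra.ι K Gen.h)
      (FreeAlgebra.ι K Gen.h * FreeAlgebra.ι K Gen.g)
  | gg : Rel K (FreeAlgebra.ι K Gen.g * FreeAlgebra.ι K Gen.g) 1
  | hh : Rel K (FreeAlgebra.ι K Gen.h * FreeAlgebra.ι K Gen.h) 1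
  | gx : Rel K (FreeAlgebra.ι K Gen.g * FreeAlgebra.ι K Gen.x)
      (-(FreeAlgebra.ι K Gen.x * FreeAlgebra.ι K Gen.g))
  | gy : Rel K (FreeAlgebra.ι K Gen.g * FreeAlgebra.ι K Gen.y)
      (-(FreeAlgebra.ι K Gen.y * FreeAlgebra.ι K Gen.g))
  | hx : Rel K (FreeAlgebra.ι K Gen.h * FreeAlgebra.ι K Gen.x)
      (-(FreeAlgebra.ι K Gen.x * FreeAlgebra.ι K Gen.h))
  | hy : Rel K (FreeAlgebra.ι K Gen.h * FreeAlgebra.ι K Gen.y)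
      (-(FreeAlgebra.ι K Gen.y * FreeAlgebra.ι K Gen.h))
  | xx : Rel K (FreeAlgebra.ι K Gen.x * FreeAlgebra.ι K Gen.x) 0
  | yy : Rel K (FreeAlgebra.ι K Gen.y * FreeAlgebra.ι K Gen.y) 0
  | xy : Rel K (FreeAlgebra.ι K Gen.x * FreeAlgebra.ι K Gen.y)
      (-(FreeAlgebra.ι K Gen.y * FreeAlgebra.ι K Gen.x))

/-- The 2-rank Taft algebra at `q = -1`: the `K`-algebra generated by `g, h, x, y` subject to
the defining relations. -/
def Taft (K : Type u) [Field K] : Type u := RingQuot (Rel K)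

variable (K : Type u) [Field K]

instance : Ring (Taft K) := inferInstanceAs (Ring (RingQuot (Rel K)))
instance : Algebra K (Taft K) := inferInstanceAs (Algebra K (RingQuot (Rel K)))

/-- The quotient map from the free algebra. -/
def Taft.mk : FreeAlgebra K Gen →ₐ[K] Taft K := RingQuot.mkAlgHom K (Rel K)

/-- The class of a generator in the algebra. -/
def Taft.gen (i : Gen) : Taft K := Taft.mk K (FreeAlgebra.ι K i)

theorem Taft.mk_rel {a b : FreeAlgebra K Gen} (H : Rel K a b) : Taft.mk K a = Taft.mk K b :=
  RingQuot.mkAlgHom_rel K H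

/-- The generators satisfy the defining relations. -/
theorem Taft.relations :
    Relations (Taft.gen K Gen.g) (Taft.gen K Gen.h) (Taft.gen K Gen.x) (Taft.gen K Gen.y) where
  gh := by simpa [Taft.gen] using Taft.mk_rel K Rel.gh
  gg := by simpa [Taft.gen] using Taft.mk_rel K Rel.gg
  hh := by simpa [Taft.gen] using Taft.mk_rel K Rel.hh
  gx := by simpa [Taft.gen] using Taft.mk_rel K Rel.gx
  gy := by simpa [Taft.gen] using Taft.mk_rel K Rel.gy
  hx := by simpa [Taft.gen] using Taft.mk_rel K Rel.hx
  hy := by simpa [Taft.gen] using Taft.mk_rel K Rel.hy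
  xx := by simpa [Taft.gen] using Taft.mk_rel K Rel.xx
  yy := by simpa [Taft.gen] using Taft.mk_rel K Rel.yy
  xy := by simpa [Taft.gen] using Taft.mk_rel K Rel.xy

variable {K}

/-- The universal property: four elements satisfying the relations define an algebra map. -/
def Taft.lift {B : Type*} [Ring B] [Algebra K B] {g h x y : B} (H : Relations g h x y) :
    Taft K →ₐ[K] B :=
  RingQuot.liftAlgHom K ⟨FreeAlgebra.lift K (Gen.val g h x y), by
    intro a b hab
    cases hab <;>
      simp [Gen.val, H.gh, H.gg, H.hh, H.gx, H.gy, H.hx, H.hy, H.xx, H.yy, H.xy]⟩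

theorem Taft.lift_gen {B : Type*} [Ring B] [Algebra K B] {g h x y : B}
    (H : Relations g h x y) (i : Gen) :
    Taft.lift (K := K) H (Taft.gen K i) = Gen.val g h x y i := by
  have := RingQuot.liftAlgHom_mkAlgHom_apply K (FreeAlgebra.lift K (Gen.val g h x y))
    (s := Rel K) (by
      intro a b hab
      cases hab <;>
        simp [Gen.val, H.gh, H.gg, H.hh, H.gx, H.gy, H.hx, H.hy, H.xx, H.yy, H.xy])
    (FreeAlgebra.ι K i)
  exact this.trans (FreeAlgebra.lift_ι_apply _ _)

theorem Taft.hom_ext {B : Type*} [Ring B] [Algebra K B] {f f' : Taft K →ₐ[K] B}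
    (H : ∀ i, f (Taft.gen K i) = f' (Taft.gen K i)) : f = f' := by
  refine RingQuot.ringQuot_ext' (S := K) f f' ?_
  refine FreeAlgebra.hom_ext ?_
  funext i
  exact H i

/-! ### The coalgebra structure -/

variable (K)

theorem Taft.comul_relations :
    Relations (B := Taft K ⊗[K] Taft K)
      (Taft.gen K Gen.g ⊗ₜ Taft.gen K Gen.g)
      (Taft.gen K Gen.h ⊗ₜ Taft.gen K Gen.h)
      (Taft.gen K Gen.x ⊗ₜ 1 + Taft.gen K Gen.g ⊗ₜ Taft.gen K Gen.x)
      (Taft.gen K Gen.y ⊗ₜ 1 + Taft.gen K Gen.h ⊗ₜ Taft.gen K Gen.y) := by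
  have H := Taft.relations K
  constructor <;>
    simp [mul_add, add_mul, Algebra.TensorProduct.one_def, TensorProduct.neg_tmul,
      TensorProduct.tmul_neg, H.gh, H.gg, H.hh, H.gx, H.gy, H.hx, H.hy, H.xx, H.yy, H.xy] <;>
    abel

theorem Taft.counit_relations : Relations (B := K) 1 1 0 0 := by
  constructor <;> simp

/-- The comultiplication: `g` and `h` are group-like, `Δ x = x ⊗ 1 + g ⊗ x` and
`Δ y = y ⊗ 1 + h ⊗ y`. -/
def Taft.comul : Taft K →ₐ[K] Taft K ⊗[K] Taft K := Taft.lift (Taft.comul_relations K)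

/-- The counit: `ε g = ε h = 1` and `ε x = ε y = 0`. -/
def Taft.counit : Taft K →ₐ[K] K := Taft.lift (Taft.counit_relations K)

instance : Bialgebra K (Taft K) :=
  Bialgebra.ofAlgHom (Taft.comul K) (Taft.counit K)
    (by
      refine Taft.hom_ext fun i => ?_
      cases i <;>
        simp [Taft.comul, Taft.lift_gen, Gen.val, TensorProduct.add_tmul,
          TensorProduct.tmul_add, Algebra.TensorProduct.one_def, add_assoc])
    (by
      refine Taft.hom_ext fun i => ?_
      cases i <;> simp [Taft.comul, Taft.counit, Taft.lift_gen, Gen.val])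
    (by
      refine Taft.hom_ext fun i => ?_
      cases i <;> simp [Taft.comul, Taft.counit, Taft.lift_gen, Gen.val])

/-! ### Tensor products of modules -/

section HTensor

variable (M N : Type*) [AddCommGroup M] [Module K M] [Module (Taft K) M]
  [IsScalarTower K (Taft K) M] [AddCommGroup N] [Module K N] [Module (Taft K) N]
  [IsScalarTower K (Taft K) N]

/-- The tensor product of two modules over the Hopf algebra `Taft K`: the space `M ⊗[K] N`, on
which an element `a` acts through `Δ a`. -/
def HTensor (M N : Type*) [AddCommGroup M] [Module K M] [AddCommGroup N] [Module K N] :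
    Type _ := M ⊗[K] N

instance : AddCommGroup (HTensor K M N) := inferInstanceAs (AddCommGroup (M ⊗[K] N))
instance : Module K (HTensor K M N) := inferInstanceAs (Module K (M ⊗[K] N))

/-- The representation of `Taft K` on the tensor product: comultiply, then let the first factor
act on `M` and the second one on `N`. -/
def HTensor.rep : Taft K →ₐ[K] Module.End K (M ⊗[K] N) :=
  ((Module.endTensorEndAlgHom (R := K) (S := K) (A := K) (M := M) (N := N)).comp
    (Algebra.TensorProduct.map (Algebra.lsmul K K M) (Algebra.lsmul K K N))).comp
      (Bialgebra.comulAlgHom K (Taft K))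

instance : Module (Taft K) (HTensor K M N) :=
  Module.compHom (M ⊗[K] N) (HTensor.rep K M N).toRingHom

instance : IsScalarTower K (Taft K) (HTensor K M N) :=
  ⟨fun c a m => by
    change HTensor.rep K M N (c • a) m = c • HTensor.rep K M N a m
    rw [map_smul]; rfl⟩

end HTensor

/-! ### Simple and projective modules -/

theorem simple_relations (s t : ℤˣ) :
    Relations (B := Module.End K K) (((s : ℤ) : K) • 1) (((t : ℤ) : K) • 1) 0 0 := by
  rcases Int.units_eq_one_or s with rfl | rfl <;>
    rcases Int.units_eq_one_or t with rfl | rfl <;> constructor <;> ext <;> simp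

/-- The one-dimensional module `S(s, t)`: the space `K` on which `g`, `h` act by the signs
`s`, `t`, and `x`, `y` act by zero. -/
def RepS (_ _ : ℤˣ) : Type u := K

section RepS

variable (s t : ℤˣ)

instance : AddCommGroup (RepS K s t) := inferInstanceAs (AddCommGroup K)
instance : Module K (RepS K s t) := inferInstanceAs (Module K K)
instance : Module (Taft K) (RepS K s t) :=
  Module.compHom K (Taft.lift (K := K) (simple_relations K s t)).toRingHom
instance : IsScalarTower K (Taft K) (RepS K s t) :=
  ⟨fun c a m => by
    change Taft.lift (K := K) (simple_relations K s t) (c • a) m =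
      c • Taft.lift (K := K) (simple_relations K s t) a m
    rw [map_smul]; rfl⟩

end RepS

/-- The primitive idempotent `(1 + s g + t h + s t g h) / 4`, on which `g` acts by `s` and `h`
acts by `t`. -/
def Taft.idem (s t : ℤˣ) : Taft K :=
  (4 : K)⁻¹ • (1 + (s : ℤ) • Taft.gen K Gen.g + (t : ℤ) • Taft.gen K Gen.h
    + ((s * t : ℤˣ) : ℤ) • (Taft.gen K Gen.g * Taft.gen K Gen.h))

/-- The projective cover `P(s, t)` of `S(s, t)`: the left ideal generated by the corresponding
primitive idempotent (an `Ideal` of a noncommutative ring is a left ideal). -/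
abbrev RepP (s t : ℤˣ) : Type u := ↥(Ideal.span {Taft.idem K s t} : Ideal (Taft K))

/-! ### String and band modules -/

section TwoStep

variable {K} {U V : Type*} [AddCommGroup U] [Module K U] [AddCommGroup V] [Module K V]

/-- The space `U ⊕ V` as a module over `Taft K` (see the instances below): both `g` and `h` act
by `1` on `U` and by `-1` on `V`, while `x` and `y` map `U` to `V` through the linear maps `X` and
`Y`, and kill `V`. -/
def TwoStep (_ _ : U →ₗ[K] V) : Type _ := U × V

variable (X Y : U →ₗ[K] V)

instance : AddCommGroup (TwoStep X Y) := inferInstanceAs (AddCommGroup (U × V))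
instance : Module K (TwoStep X Y) := inferInstanceAs (Module K (U × V))

/-- The action of `g` and of `h`. -/
def TwoStep.sgn : Module.End K (U × V) :=
  LinearMap.prodMap LinearMap.id (-LinearMap.id)

/-- The map `(u, v) ↦ (0, Z u)`. -/
def TwoStep.shift (Z : U →ₗ[K] V) : Module.End K (U × V) :=
  LinearMap.inr K U V ∘ₗ Z ∘ₗ LinearMap.fst K U V

theorem TwoStep.relations :
    Relations (B := Module.End K (U × V)) TwoStep.sgn TwoStep.sgn
      (TwoStep.shift X) (TwoStep.shift Y) := by
  constructor <;> ext <;> simp [TwoStep.sgn, TwoStep.shift]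

instance : Module (Taft K) (TwoStep X Y) :=
  Module.compHom (U × V) (Taft.lift (K := K) (TwoStep.relations X Y)).toRingHom
instance : IsScalarTower K (Taft K) (TwoStep X Y) :=
  ⟨fun c a m => by
    change Taft.lift (K := K) (TwoStep.relations X Y) (c • a) m =
      c • Taft.lift (K := K) (TwoStep.relations X Y) a m
    rw [map_smul]; rfl⟩

end TwoStep

/-- The standard basis `v_1, …, v_n` of `Kⁿ`, numbered from `1` and extended by `v_k = 0` for
`k = 0` and `k > n`. -/
def bv (n k : ℕ) : Fin n → K := fun j => if (j : ℕ) + 1 = k then 1 else 0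

/-- The linear map `Kᵐ → Kⁿ` with `u_i ↦ f i` for `1 ≤ i ≤ m`. -/
def onBasis (m n : ℕ) (f : ℕ → (Fin n → K)) : (Fin m → K) →ₗ[K] (Fin n → K) :=
  (Pi.basisFun K (Fin m)).constr K fun i => f ((i : ℕ) + 1)

/-- `M(r)`: basis `u_1, …, u_r, v_1, …, v_{r+1}` with `x u_i = v_i` and `y u_i = v_{i+1}`. -/
abbrev RepM (r : ℕ) : Type u :=
  TwoStep (onBasis K r (r + 1) fun i => bv K (r + 1) i)
    (onBasis K r (r + 1) fun i => bv K (r + 1) (i + 1))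

/-- `W(r)`: basis `u_1, …, u_{r+1}, v_1, …, v_r` with `x u_i = v_i` and `y u_i = v_{i-1}`, where
`v_0 = v_{r+1} = 0`. -/
abbrev RepW (r : ℕ) : Type u :=
  TwoStep (onBasis K (r + 1) r fun i => bv K r i)
    (onBasis K (r + 1) r fun i => bv K r (i - 1))

/-- `N(r)`: basis `u_1, …, u_r, v_1, …, v_r` with `x u_i = v_i` and `y u_i = v_{i-1}`, where
`v_0 = 0`. -/
abbrev RepN (r : ℕ) : Type u :=
  TwoStep (onBasis K r r fun i => bv K r i) (onBasis K r r fun i => bv K r (i - 1))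

/-- `N'(r)`: basis `u_1, …, u_r, v_1, …, v_r` with `x u_i = v_{i-1}` and `y u_i = v_i`, where
`v_0 = 0`. -/
abbrev RepN' (r : ℕ) : Type u :=
  TwoStep (onBasis K r r fun i => bv K r (i - 1)) (onBasis K r r fun i => bv K r i)

/-- `C(r, η)`: basis `u_1, …, u_r, v_1, …, v_r` with `x u_i = v_i` and
`y u_i = η v_i + v_{i-1}`, where `v_0 = 0`. -/
abbrev RepC (r : ℕ) (η : K) : Type u :=
  TwoStep (onBasis K r r fun i => bv K r i)
    (onBasis K r r fun i => η • bv K r i + bv K r (i - 1))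

/-- `M₋ = M ⊗ S(-, -)`. -/
abbrev Minus (M : Type u) [AddCommGroup M] [Module K M] : Type u :=
  HTensor K M (RepS K (-1) (-1))

end TaftTwo

end

open TaftTwo

/-!
The projective module `P` has the basis `e, xe, ye, xye` (`RepP.equiv`), its socle is spanned by
`xye`, and it is injective as well as projective. So a copy of `P` splits off a module `T` for every
invariant vector on which `xy` does not vanish, and the theorem reduces to computing the map `xy` on
the invariant vectors of a tensor product and recognizing a complement. If `n` invariant vectors
have linearly independent images under `xy`, the complement may be given either as a submodule whose
intersection with the span of these images is zero (`split_of_injective`), or as a quotient of `T`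
on which the vectors vanish (`split_of_surjective`, which uses that `P` is injective, in the form of
`exists_retraction`); a count of dimensions does the rest.

All the modules `M(r)`, `W(r)`, `N(r)`, `N'(r)`, `C(r, η)` are of the form `U ⊕ V`, given by a pair
of maps `X, Y : U → V`. On the tensor product of `U ⊕ V` and `U' ⊕ V'`, the product `xy` maps
`U ⊗ U'` to `V ⊗ V'` by `D = X ⊗ Y' - Y ⊗ X'` (`TwoStep.socleMap`, `TwoStep.coord_xy_topIncl`), and
kills the other invariant vectors.

* If `D` is bijective, the tensor product is projective (`TwoStep.split_of_bijective`). This is the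
  case of two indecomposable pencils without a common eigenvalue (`TwoStep.band_tensor_bijective`).
* If `D` is surjective, the complement is a submodule with top the kernel of `D`
  (`TwoStep.split_of_kernel`). This covers the products with `W(r)`, and `M(r) ⊗ W(s)` for `r > s`.
* If `D` is injective, the complement is a quotient with socle the cokernel of `D`, twisted by `S`
  (`TwoStep.split_of_cokernel`). This covers the products with `M(r)`, and `M(r) ⊗ W(s)` for
  `r ≤ s`; the module `S` arises as the twist of `W(0)` when `r = s`.
* The remaining products, of two modules of one of the families `C(-, η)`, `N`, `N'`, have a `D`
  with both a kernel and a cokernel, of dimension `min r s`. Here `X = a + bJ` and `Y = c + dJ` for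
  a nilpotent Jordan block `J` and `ad - bc ≠ 0`, and `D` is `ad - bc` times `1 ⊗ J - J ⊗ 1`. For
  `s ≤ r` both the smaller factor and its twist are found as explicit submodules
  (`TwoStep.pencil_tensor_of_le`), and the case `r < s` follows by exchanging the factors
  (`TwoStep.nonempty_swap`).

The products with `P` need no decomposition of the other factor beyond a basis of eigenvectors for
`g` and `h`, since `m ⊗ e` generates a copy of `P(s, s)` when `g` and `h` act on `m` by `s`
(`tensor_P`).
-/

noncomputable section

namespace TaftTwo

open Module

universe u

/-! ### Linear maps over the Taft algebra -/

section Generators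

variable {K : Type*} [Field K]

theorem Taft.gen_induction {p : Taft K → Prop} (scalar : ∀ c, p (algebraMap K (Taft K) c))
    (gen : ∀ i, p (Taft.gen K i)) (add : ∀ a b, p a → p b → p (a + b))
    (mul : ∀ a b, p a → p b → p (a * b)) (a : Taft K) : p a := by
  obtain ⟨b, rfl⟩ : ∃ b, Taft.mk K b = a := RingQuot.mkAlgHom_surjective K (Rel K) a
  induction b using FreeAlgebra.induction with
  | grade0 c => rw [AlgHom.commutes]; exact scalar c
  | grade1 i => exact gen i
  | mul a b ha hb => rw [map_mul]; exact mul _ _ ha hb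
  | add a b ha hb => rw [map_add]; exact add _ _ ha hb

variable {M N : Type*} [AddCommGroup M] [Module K M] [Module (Taft K) M]
  [IsScalarTower K (Taft K) M] [AddCommGroup N] [Module K N] [Module (Taft K) N]
  [IsScalarTower K (Taft K) N]

/-- A `K`-linear map commuting with the generators is linear over the Taft algebra. -/
def Taft.homOfGen (f : M →ₗ[K] N) (hf : ∀ i m, f (Taft.gen K i • m) = Taft.gen K i • f m) :
    M →ₗ[Taft K] N where
  toFun := f
  map_add' := map_add f
  map_smul' a := by
    induction a using Taft.gen_induction with
    | scalar c => intro m; simp [algebraMap_smul]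
    | gen i => exact hf i
    | add a b ha hb => intro m; simp_all [add_smul]
    | mul a b ha hb => intro m; simp_all [mul_smul]

@[simp]
theorem Taft.homOfGen_apply (f : M →ₗ[K] N)
    (hf : ∀ i m, f (Taft.gen K i • m) = Taft.gen K i • f m) (m : M) :
    Taft.homOfGen f hf m = f m := rfl

theorem Taft.nonempty_equiv_of_gen (f : M ≃ₗ[K] N)
    (hf : ∀ i m, f (Taft.gen K i • m) = Taft.gen K i • f m) : Nonempty (M ≃ₗ[Taft K] N) :=
  ⟨LinearEquiv.ofBijective (Taft.homOfGen f.toLinearMap hf) f.bijective⟩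

theorem Taft.nonempty_equiv_of_injective [FiniteDimensional K M] [FiniteDimensional K N]
    (f : M →ₗ[Taft K] N) (hf : Function.Injective f) (h : finrank K M = finrank K N) :
    Nonempty (M ≃ₗ[Taft K] N) :=
  ⟨LinearEquiv.ofBijective f ⟨hf, (LinearMap.injective_iff_surjective_of_finrank_eq_finrank
    (f := f.restrictScalars K) h).1 hf⟩⟩

theorem Taft.nonempty_equiv_of_surjective [FiniteDimensional K M] [FiniteDimensional K N]
    (f : M →ₗ[Taft K] N) (hf : Function.Surjective f) (h : finrank K M = finrank K N) :
    Nonempty (M ≃ₗ[Taft K] N) :=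
  ⟨LinearEquiv.ofBijective f ⟨(LinearMap.injective_iff_surjective_of_finrank_eq_finrank
    (f := f.restrictScalars K) h).2 hf, hf⟩⟩

end Generators

/-! ### The relations, acting on a module -/

section Smul

variable {K : Type*} [Field K] {M : Type*} [AddCommGroup M] [Module (Taft K) M]

theorem gg_smul (m : M) : Taft.gen K .g • Taft.gen K .g • m = m := by
  rw [smul_smul, (Taft.relations K).gg, one_smul]

theorem hh_smul (m : M) : Taft.gen K .h • Taft.gen K .h • m = m := by
  rw [smul_smul, (Taft.relations K).hh, one_smul]

theorem hg_smul (m : M) :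
    Taft.gen K .h • Taft.gen K .g • m = Taft.gen K .g • Taft.gen K .h • m := by
  rw [smul_smul, smul_smul, (Taft.relations K).gh]

theorem gx_smul (m : M) :
    Taft.gen K .g • Taft.gen K .x • m = -(Taft.gen K .x • Taft.gen K .g • m) := by
  rw [smul_smul, (Taft.relations K).gx, neg_smul, mul_smul]

theorem gy_smul (m : M) :
    Taft.gen K .g • Taft.gen K .y • m = -(Taft.gen K .y • Taft.gen K .g • m) := by
  rw [smul_smul, (Taft.relations K).gy, neg_smul, mul_smul]

theorem hx_smul (m : M) :
    Taft.gen K .h • Taft.gen K .x • m = -(Taft.gen K .x • Taft.gen K .h • m) := by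
  rw [smul_smul, (Taft.relations K).hx, neg_smul, mul_smul]

theorem hy_smul (m : M) :
    Taft.gen K .h • Taft.gen K .y • m = -(Taft.gen K .y • Taft.gen K .h • m) := by
  rw [smul_smul, (Taft.relations K).hy, neg_smul, mul_smul]

theorem xx_smul (m : M) : Taft.gen K .x • Taft.gen K .x • m = 0 := by
  rw [smul_smul, (Taft.relations K).xx, zero_smul]

theorem yy_smul (m : M) : Taft.gen K .y • Taft.gen K .y • m = 0 := by
  rw [smul_smul, (Taft.relations K).yy, zero_smul]

theorem yx_smul (m : M) :
    Taft.gen K .y • Taft.gen K .x • m = -(Taft.gen K .x • Taft.gen K .y • m) := by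
  rw [smul_smul, smul_smul, (Taft.relations K).xy, neg_smul, neg_neg]

theorem xyx_smul (m : M) : Taft.gen K .x • Taft.gen K .y • Taft.gen K .x • m = 0 := by
  rw [yx_smul, smul_neg, xx_smul, neg_zero]

variable [Module K M] [IsScalarTower K (Taft K) M]

theorem idem_smul (s t : ℤˣ) (m : M) :
    Taft.idem K s t • m = (4 : K)⁻¹ • (m + ((s : ℤ) : K) • Taft.gen K .g • m
      + ((t : ℤ) : K) • Taft.gen K .h • m
      + ((s : ℤ) : K) • ((t : ℤ) : K) • Taft.gen K .g • Taft.gen K .h • m) := by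
  simp only [Taft.idem, smul_assoc, add_smul, one_smul, mul_smul, Units.val_mul,
    Int.cast_smul_eq_zsmul]

theorem idem_smul_of_eigen [CharZero K] {s t : ℤˣ} {m : M}
    (hg : Taft.gen K .g • m = ((s : ℤ) : K) • m) (hh : Taft.gen K .h • m = ((t : ℤ) : K) • m) :
    Taft.idem K s t • m = m := by
  rw [idem_smul, hh, smul_comm (Taft.gen K .g) (_ : K), hg]
  have h4 : (4 : K) ≠ 0 := by norm_num
  rcases Int.units_eq_one_or s with rfl | rfl <;> rcases Int.units_eq_one_or t with rfl | rfl <;>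
    · rw [inv_smul_eq_iff₀ h4]
      push_cast
      module

theorem gen_g_smul_idem_smul (s t : ℤˣ) (m : M) :
    Taft.gen K .g • Taft.idem K s t • m = ((s : ℤ) : K) • Taft.idem K s t • m := by
  rw [idem_smul]
  simp only [smul_add, smul_comm (Taft.gen K .g) (_ : K), gg_smul]
  generalize Taft.gen K .g • Taft.gen K .h • m = a
  generalize Taft.gen K .g • m = b
  generalize Taft.gen K .h • m = c
  rcases Int.units_eq_one_or s with rfl | rfl <;> push_cast <;> module

theorem gen_h_smul_idem_smul (s t : ℤˣ) (m : M) :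
    Taft.gen K .h • Taft.idem K s t • m = ((t : ℤ) : K) • Taft.idem K s t • m := by
  rw [idem_smul]
  simp only [smul_add, smul_comm (Taft.gen K .h) (_ : K), hg_smul, hh_smul]
  generalize Taft.gen K .g • Taft.gen K .h • m = a
  generalize Taft.gen K .g • m = b
  generalize Taft.gen K .h • m = c
  rcases Int.units_eq_one_or t with rfl | rfl <;> push_cast <;> module

theorem idem_smul_gen_g_smul (s t : ℤˣ) (m : M) :
    Taft.idem K s t • Taft.gen K .g • m = ((s : ℤ) : K) • Taft.idem K s t • m := by
  rw [idem_smul, idem_smul]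
  simp only [hg_smul, gg_smul]
  generalize Taft.gen K .g • Taft.gen K .h • m = a
  generalize Taft.gen K .g • m = b
  generalize Taft.gen K .h • m = c
  rcases Int.units_eq_one_or s with rfl | rfl <;> push_cast <;> module

theorem idem_smul_gen_h_smul (s t : ℤˣ) (m : M) :
    Taft.idem K s t • Taft.gen K .h • m = ((t : ℤ) : K) • Taft.idem K s t • m := by
  rw [idem_smul, idem_smul]
  simp only [hh_smul]
  generalize Taft.gen K .g • Taft.gen K .h • m = a
  generalize Taft.gen K .g • m = b
  generalize Taft.gen K .h • m = c
  rcases Int.units_eq_one_or t with rfl | rfl <;> push_cast <;> module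

end Smul

/-! ### The projective modules -/

namespace RepP

variable (K : Type*) [Field K] (s t : ℤˣ)

/-- The generator of `P(s, t)`, namely the idempotent itself. -/
def top : RepP K s t := ⟨Taft.idem K s t, Ideal.subset_span rfl⟩

theorem g_smul_top : Taft.gen K .g • top K s t = ((s : ℤ) : K) • top K s t := by
  have := gen_g_smul_idem_smul (K := K) s t (1 : Taft K)
  simp only [smul_eq_mul, mul_one] at this
  exact Subtype.ext this

theorem h_smul_top : Taft.gen K .h • top K s t = ((t : ℤ) : K) • top K s t := by
  have := gen_h_smul_idem_smul (K := K) s t (1 : Taft K)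
  simp only [smul_eq_mul, mul_one] at this
  exact Subtype.ext this

/-- The element of `P(s, t)` with the given coordinates in the basis `e, xe, ye, xye`, where `e`
is the generator. -/
def ofCoord : K × K × K × K →ₗ[K] RepP K s t where
  toFun a := a.1 • top K s t + a.2.1 • Taft.gen K .x • top K s t
    + a.2.2.1 • Taft.gen K .y • top K s t
    + a.2.2.2 • Taft.gen K .x • Taft.gen K .y • top K s t
  map_add' a b := by
    simp only [Prod.fst_add, Prod.snd_add, add_smul]
    abel
  map_smul' c a := by
    simp only [Prod.smul_fst, Prod.smul_snd, smul_assoc, smul_add, RingHom.id_apply]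

theorem g_smul_ofCoord (a b c d : K) : Taft.gen K .g • ofCoord K s t (a, b, c, d)
    = ofCoord K s t (((s : ℤ) : K) • (a, -b, -c, d)) := by
  simp only [ofCoord, LinearMap.coe_mk, AddHom.coe_mk, smul_add, smul_comm (Taft.gen K _) (_ : K),
    g_smul_top, gx_smul, gy_smul, smul_neg, Prod.smul_mk, smul_assoc, neg_smul, neg_neg,
    smul_comm ((s : ℤ) : K) (_ : K)]

theorem h_smul_ofCoord (a b c d : K) : Taft.gen K .h • ofCoord K s t (a, b, c, d)
    = ofCoord K s t (((t : ℤ) : K) • (a, -b, -c, d)) := by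
  simp only [ofCoord, LinearMap.coe_mk, AddHom.coe_mk, smul_add, smul_comm (Taft.gen K _) (_ : K),
    h_smul_top, hx_smul, hy_smul, smul_neg, Prod.smul_mk, smul_assoc, neg_smul, neg_neg,
    smul_comm ((t : ℤ) : K) (_ : K)]

theorem gen_smul_ofCoord (i : Gen) (a : K × K × K × K) :
    ∃ b, Taft.gen K i • ofCoord K s t a = ofCoord K s t b := by
  obtain ⟨a, b, c, d⟩ := a
  cases i
  · exact ⟨_, g_smul_ofCoord K s t a b c d⟩
  · exact ⟨_, h_smul_ofCoord K s t a b c d⟩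
  · refine ⟨(0, a, 0, c), ?_⟩
    simp only [ofCoord, LinearMap.coe_mk, AddHom.coe_mk, smul_add, smul_comm (Taft.gen K _) (_ : K),
      xx_smul, smul_zero, zero_smul, add_zero, zero_add]
  · refine ⟨(0, 0, a, -b), ?_⟩
    simp only [ofCoord, LinearMap.coe_mk, AddHom.coe_mk, smul_add, smul_comm (Taft.gen K _) (_ : K),
      yx_smul, yy_smul, smul_neg, smul_zero, neg_smul, zero_smul, neg_zero, add_zero, zero_add]

theorem ofCoord_surjective : Function.Surjective (ofCoord K s t) := by
  have key : ∀ a : Taft K, ∀ b, ∃ c, a • ofCoord K s t b = ofCoord K s t c := by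
    intro a
    induction a using Taft.gen_induction with
    | scalar c => exact fun b => ⟨c • b, by rw [algebraMap_smul, map_smul]⟩
    | gen i => exact gen_smul_ofCoord K s t i
    | add a₁ a₂ h₁ h₂ =>
      intro b
      obtain ⟨c₁, h₁⟩ := h₁ b
      obtain ⟨c₂, h₂⟩ := h₂ b
      exact ⟨c₁ + c₂, by rw [add_smul, h₁, h₂, map_add]⟩
    | mul a₁ a₂ h₁ h₂ =>
      intro b
      obtain ⟨c₂, h₂⟩ := h₂ b
      obtain ⟨c₁, h₁⟩ := h₁ c₂
      exact ⟨c₁, by rw [mul_smul, h₂, h₁]⟩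
  rintro ⟨p, hp⟩
  obtain ⟨a, rfl⟩ := Ideal.mem_span_singleton'.1 hp
  obtain ⟨c, hc⟩ := key a (1, 0, 0, 0)
  refine ⟨c, hc.symm.trans (Subtype.ext ?_)⟩
  simp [ofCoord, top]

/-- The matrices of the generators acting on `P(s, t)` in the basis `e, xe, ye, xye`. -/
theorem coord_relations : Relations (B := Module.End K (K × K × K × K))
    (((s : ℤ) : K) • LinearMap.prodMap LinearMap.id (LinearMap.prodMap (-LinearMap.id)
      (LinearMap.prodMap (-LinearMap.id) LinearMap.id)))
    (((t : ℤ) : K) • LinearMap.prodMap LinearMap.id (LinearMap.prodMap (-LinearMap.id)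
      (LinearMap.prodMap (-LinearMap.id) LinearMap.id)))
    ((0 : _ →ₗ[K] K).prod ((LinearMap.fst K K _).prod ((0 : _ →ₗ[K] K).prod
      (LinearMap.fst K K K ∘ₗ LinearMap.snd K K _ ∘ₗ LinearMap.snd K K _))))
    ((0 : _ →ₗ[K] K).prod ((0 : _ →ₗ[K] K).prod ((LinearMap.fst K K _).prod
      (-(LinearMap.fst K K _ ∘ₗ LinearMap.snd K K _))))) := by
  rcases Int.units_eq_one_or s with rfl | rfl <;>
    rcases Int.units_eq_one_or t with rfl | rfl <;> constructor <;>
    refine LinearMap.ext ?_ <;> rintro ⟨a, b, c, d⟩ <;> simp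

variable [CharZero K]

theorem ofCoord_injective : Function.Injective (ofCoord K s t) := by
  -- evaluating the matrix representation at the first basis vector reads off the coordinates
  let ρ : Taft K →ₐ[K] Module.End K (K × K × K × K) := Taft.lift (coord_relations K s t)
  have hs : ((s : ℤ) : K) * ((s : ℤ) : K) = 1 := by
    rcases Int.units_eq_one_or s with rfl | rfl <;> simp
  have ht : ((t : ℤ) : K) * ((t : ℤ) : K) = 1 := by
    rcases Int.units_eq_one_or t with rfl | rfl <;> simp
  have htop : ρ (Taft.idem K s t) (1, 0, 0, 0) = (1, 0, 0, 0) := by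
    have h4 : (4 : K) ≠ 0 := by norm_num
    rcases Int.units_eq_one_or s with rfl | rfl <;>
      rcases Int.units_eq_one_or t with rfl | rfl <;>
      · simp [ρ, Taft.idem, Taft.lift_gen, Gen.val]
        field_simp
        norm_num
  refine Function.LeftInverse.injective
    (g := fun p : RepP K s t => ρ p.1 (1, 0, 0, 0)) ?_
  rintro ⟨a, b, c, d⟩
  have : (ofCoord K s t (a, b, c, d)).1 = a • Taft.idem K s t
      + b • (Taft.gen K .x * Taft.idem K s t) + c • (Taft.gen K .y * Taft.idem K s t)
      + d • (Taft.gen K .x * (Taft.gen K .y * Taft.idem K s t)) := rfl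
  simp only [this, map_add, map_smul, map_mul, LinearMap.add_apply, LinearMap.smul_apply,
    Module.End.mul_apply, htop]
  simp [ρ, Taft.lift_gen, Gen.val]

/-- Coordinates on `P(s, t)` in the basis `e, xe, ye, xye`. -/
def equiv : RepP K s t ≃ₗ[K] K × K × K × K :=
  (LinearEquiv.ofBijective (ofCoord K s t)
    ⟨ofCoord_injective K s t, ofCoord_surjective K s t⟩).symm

theorem equiv_symm_apply (a : K × K × K × K) : (equiv K s t).symm a = ofCoord K s t a := rfl

instance : FiniteDimensional K (RepP K s t) := Module.Finite.equiv (equiv K s t).symm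

theorem finrank_eq : finrank K (RepP K s t) = 4 := by
  rw [(equiv K s t).finrank_eq]; simp

end RepP

/-! ### Splitting off projective summands -/

namespace RepP

variable {K : Type*} [Field K] {s t : ℤˣ} {T : Type*} [AddCommGroup T] [Module (Taft K) T]

/-- The homomorphism out of `P(s, t)` given by acting on `m`. -/
def lift (m : T) : RepP K s t →ₗ[Taft K] T :=
  (LinearMap.toSpanSingleton (Taft K) T m).comp (Submodule.subtype _)

variable [CharZero K] [Module K T] [IsScalarTower K (Taft K) T]

theorem lift_ofCoord {m : T}
    (hg : Taft.gen K .g • m = ((s : ℤ) : K) • m) (hh : Taft.gen K .h • m = ((t : ℤ) : K) • m)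
    (a : K × K × K × K) :
    lift m (ofCoord K s t a) = a.1 • m + a.2.1 • Taft.gen K .x • m + a.2.2.1 • Taft.gen K .y • m
      + a.2.2.2 • Taft.gen K .x • Taft.gen K .y • m := by
  have htop : lift m (top K s t) = m := idem_smul_of_eigen hg hh
  simp [ofCoord, htop]

end RepP

section Sum

variable {K : Type*} [Field K] [CharZero K] {ι : Type*} [Fintype ι] {s : ι → ℤˣ}
  {T : Type*} [AddCommGroup T] [Module (Taft K) T]

/-- The homomorphism from a sum of modules `P(s, s)` sending their generators to the vectors
`m i`. -/
def sumLift (s : ι → ℤˣ) (m : ι → T) : (∀ i, RepP K (s i) (s i)) →ₗ[Taft K] T :=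
  ∑ i, (RepP.lift (m i)).comp (LinearMap.proj i)

variable [Module K T] [IsScalarTower K (Taft K) T]

/-- The vectors `m i` are eigenvectors of `g` and of `h`, both with eigenvalue `s i`. -/
def IsEigen (K : Type*) [Field K] {T : Type*} [AddCommGroup T] [Module (Taft K) T] [Module K T]
    {ι : Type*} (s : ι → ℤˣ) (m : ι → T) : Prop :=
  ∀ i, Taft.gen K .g • m i = ((s i : ℤ) : K) • m i ∧ Taft.gen K .h • m i = ((s i : ℤ) : K) • m i

/-- The coordinates of a vector in a sum of modules `P(s, s)`. -/
def sumCoord (s : ι → ℤˣ) (p : ∀ i, RepP K (s i) (s i)) (i : ι) : K × K × K × K :=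
  RepP.equiv K (s i) (s i) (p i)

omit [Fintype ι] in
theorem ofCoord_sumCoord (p : ∀ i, RepP K (s i) (s i)) (i : ι) :
    RepP.ofCoord K (s i) (s i) (sumCoord s p i) = p i :=
  (RepP.equiv K (s i) (s i)).symm_apply_apply (p i)

theorem sumLift_apply {m : ι → T} (hm : IsEigen K s m) (p : ∀ i, RepP K (s i) (s i)) :
    sumLift s m p = ∑ i, (sumCoord s p i).1 • m i
      + Taft.gen K .x • ∑ i, (sumCoord s p i).2.1 • m i
      + Taft.gen K .y • ∑ i, (sumCoord s p i).2.2.1 • m i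
      + Taft.gen K .x • Taft.gen K .y • ∑ i, (sumCoord s p i).2.2.2 • m i := by
  simp only [Finset.smul_sum, ← Finset.sum_add_distrib, sumLift, LinearMap.sum_apply,
    LinearMap.comp_apply, LinearMap.proj_apply]
  refine Finset.sum_congr rfl fun i _ => ?_
  conv_lhs => rw [← ofCoord_sumCoord p i, RepP.lift_ofCoord (hm i).1 (hm i).2]
  simp only [smul_comm (Taft.gen K _) (_ : K)]

theorem finrank_sum : finrank K (∀ i, RepP K (s i) (s i)) = 4 * Fintype.card ι := by
  rw [Module.finrank_pi_fintype]
  simp [RepP.finrank_eq, mul_comm]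

variable {R : Type*} [AddCommGroup R] [Module (Taft K) R]

omit [CharZero K] [IsScalarTower K (Taft K) T] in
/-- The socle of a sum of modules `P(s, s)` is spanned by the vectors `xye`, so that independence
of these from `R` suffices for independence of all the basis vectors. -/
theorem coeff_eq_zero {m : ι → T} (σ : R →ₗ[Taft K] T) (hσ : Function.Injective σ)
    (H : ∀ c : ι → K, ∀ r, Taft.gen K .x • Taft.gen K .y • ∑ i, c i • m i = σ r → c = 0)
    {a b c d : ι → K} {r : R} (h : ∑ i, a i • m i + Taft.gen K .x • ∑ i, b i • m i
      + Taft.gen K .y • ∑ i, c i • m i + Taft.gen K .x • Taft.gen K .y • ∑ i, d i • m i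
      + σ r = 0) : a = 0 ∧ b = 0 ∧ c = 0 ∧ d = 0 ∧ r = 0 := by
  -- multiplying by `xy`, `y`, `x` and `1` isolates the coordinates one after the other
  obtain rfl : a = 0 := by
    refine H a (Taft.gen K .x • Taft.gen K .y • (-r)) ?_
    have := congrArg (fun t => Taft.gen K .x • Taft.gen K .y • t) h
    simp only [smul_add, yy_smul, xyx_smul, smul_zero, add_zero] at this
    rw [map_smul, map_smul, map_neg, smul_neg, smul_neg]
    exact eq_neg_of_add_eq_zero_left this
  simp only [Pi.zero_apply, zero_smul, Finset.sum_const_zero, zero_add] at h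
  obtain rfl : b = 0 := by
    refine H b (Taft.gen K .y • r) ?_
    have := congrArg (fun t => Taft.gen K .y • t) h
    simp only [smul_add, yy_smul, yx_smul, smul_zero, add_zero, neg_zero] at this
    rw [map_smul]
    exact neg_add_eq_zero.1 this
  simp only [Pi.zero_apply, zero_smul, Finset.sum_const_zero, zero_add, smul_zero] at h
  obtain rfl : c = 0 := by
    refine H c (Taft.gen K .x • (-r)) ?_
    have := congrArg (fun t => Taft.gen K .x • t) h
    simp only [smul_add, xx_smul, smul_zero, add_zero] at this
    rw [map_smul, map_neg, smul_neg]
    exact eq_neg_of_add_eq_zero_left this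
  simp only [Pi.zero_apply, zero_smul, Finset.sum_const_zero, zero_add, smul_zero] at h
  obtain rfl : d = 0 := by
    refine H d (-r) ?_
    rw [map_neg]
    exact eq_neg_of_add_eq_zero_left h
  simp only [Pi.zero_apply, zero_smul, Finset.sum_const_zero, zero_add, smul_zero] at h
  exact ⟨rfl, rfl, rfl, rfl, (map_eq_zero_iff σ hσ).1 h⟩

omit [Fintype ι] in
theorem eq_zero_of_sumCoord {p : ∀ i, RepP K (s i) (s i)} (ha : (fun i => (sumCoord s p i).1) = 0)
    (hb : (fun i => (sumCoord s p i).2.1) = 0) (hc : (fun i => (sumCoord s p i).2.2.1) = 0)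
    (hd : (fun i => (sumCoord s p i).2.2.2) = 0) : p = 0 := by
  funext i
  rw [← ofCoord_sumCoord p i, show sumCoord s p i = 0 from Prod.ext (congrFun ha i)
    (Prod.ext (congrFun hb i) (Prod.ext (congrFun hc i) (congrFun hd i))), map_zero]
  rfl

theorem coprod_sumLift_injective {m : ι → T} (hm : IsEigen K s m) (σ : R →ₗ[Taft K] T)
    (hσ : Function.Injective σ)
    (h : ∀ c : ι → K, ∀ r, Taft.gen K .x • Taft.gen K .y • ∑ i, c i • m i = σ r → c = 0) :
    Function.Injective ((sumLift s m).coprod σ) := by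
  rw [injective_iff_map_eq_zero]
  rintro ⟨p, r⟩ hp
  rw [LinearMap.coprod_apply, sumLift_apply hm] at hp
  obtain ⟨ha, hb, hc, hd, hr⟩ := coeff_eq_zero σ hσ h hp
  exact Prod.ext (eq_zero_of_sumCoord ha hb hc hd) hr

end Sum

section Splitting

variable {K : Type*} [Field K] [CharZero K]
  {T : Type*} [AddCommGroup T] [Module (Taft K) T] [Module K T] [IsScalarTower K (Taft K) T]
  {R : Type*} [AddCommGroup R] [Module (Taft K) R] [Module K R] [IsScalarTower K (Taft K) R]
  {F : Type*} [AddCommGroup F] [Module K F] {n : ℕ}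

omit [CharZero K] [Module (Taft K) T] [IsScalarTower K (Taft K) T] in
theorem smul_sum_basis (f : F →ₗ[K] T) (b : Basis (Fin n) K F) (c : Fin n → K) :
    ∑ i, c i • f (b i) = f (b.equivFun.symm c) := by
  simp [Basis.equivFun_symm_apply]

omit [CharZero K] [IsScalarTower K (Taft K) T] in
theorem isEigen_one {f : F →ₗ[K] T} (hg : ∀ w, Taft.gen K .g • f w = f w)
    (hh : ∀ w, Taft.gen K .h • f w = f w) (v : Fin n → F) :
    IsEigen K (fun _ => 1) (fun i => f (v i)) := fun i => by simp [hg, hh]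

/-- A submodule `R` of `T` and `dim F` copies of the projective module `P` generated by invariant
vectors make up `T` when the socle of the latter is independent of `R` and the dimensions fit. -/
theorem split_of_injective [FiniteDimensional K T] [FiniteDimensional K R]
    [FiniteDimensional K F] (f : F →ₗ[K] T)
    (hg : ∀ w, Taft.gen K .g • f w = f w) (hh : ∀ w, Taft.gen K .h • f w = f w)
    (σ : R →ₗ[K] T) (hσ : ∀ i r, σ (Taft.gen K i • r) = Taft.gen K i • σ r)
    (hinj : Function.Injective σ)
    (hind : ∀ w r, Taft.gen K .x • Taft.gen K .y • f w = σ r → w = 0)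
    (hF : finrank K F = n) (hT : finrank K T = 4 * n + finrank K R) :
    Nonempty (T ≃ₗ[Taft K] (Fin n → RepP K 1 1) × R) := by
  let b := finBasisOfFinrankEq K F hF
  have hm := isEigen_one hg hh b
  have := coprod_sumLift_injective hm (Taft.homOfGen σ hσ) hinj (fun c r h => by
    rw [smul_sum_basis] at h
    exact b.equivFun.symm.map_eq_zero_iff.1 (hind _ r h))
  obtain ⟨e⟩ := Taft.nonempty_equiv_of_injective _ this (by
    rw [finrank_prod, hT, finrank_sum, Fintype.card_fin])
  exact ⟨e.symm⟩

/-- The sum of copies of the projective module `P` generated by invariant vectors, on which `xy`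
is injective, is a direct summand: the module `P` is injective as well. -/
theorem exists_retraction [FiniteDimensional K F] (f : F →ₗ[K] T)
    (hg : ∀ w, Taft.gen K .g • f w = f w) (hh : ∀ w, Taft.gen K .h • f w = f w)
    (hind : ∀ w, Taft.gen K .x • Taft.gen K .y • f w = 0 → w = 0)
    (b : Basis (Fin n) K F) :
    ∃ ρ : T →ₗ[Taft K] (Fin n → RepP K 1 1),
      Function.Surjective (ρ.comp (sumLift (fun _ => 1) fun i => f (b i))) := by
  have lsm : ∀ a : Taft K, ∃ L : T →ₗ[K] T, ∀ t, L t = a • t := fun a =>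
    ⟨Algebra.lsmul K K T a, fun t => rfl⟩
  obtain ⟨I, hI⟩ := lsm (Taft.idem K 1 1)
  obtain ⟨Lx, hLx⟩ := lsm (Taft.gen K .x)
  obtain ⟨Ly, hLy⟩ := lsm (Taft.gen K .y)
  obtain ⟨lam, hlam⟩ := LinearMap.exists_leftInverse_of_injective (Lx ∘ₗ Ly ∘ₗ f)
    (LinearMap.ker_eq_bot'.2 fun w hw => hind w (by simpa [hLx, hLy] using hw))
  -- averaging makes the functional invariant under `g` and `h`
  obtain ⟨μ, hμ⟩ : ∃ μ : T →ₗ[K] F, μ = lam ∘ₗ I := ⟨_, rfl⟩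
  have μg : ∀ t, μ (Taft.gen K .g • t) = μ t := fun t => by simp [hμ, hI, idem_smul_gen_g_smul]
  have μh : ∀ t, μ (Taft.gen K .h • t) = μ t := fun t => by simp [hμ, hI, idem_smul_gen_h_smul]
  have μxy : ∀ w, μ (Taft.gen K .x • Taft.gen K .y • f w) = w := fun w => by
    have h1 : Taft.idem K 1 1 • Taft.gen K .x • Taft.gen K .y • f w
        = Taft.gen K .x • Taft.gen K .y • f w := by
      apply idem_smul_of_eigen
      · simp [gx_smul, gy_smul, hg]
      · simp [hx_smul, hy_smul, hh]
    rw [hμ, LinearMap.comp_apply, hI, h1]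
    simpa [hLx, hLy] using LinearMap.congr_fun hlam w
  have half : ∀ v : F, v = -v → v = 0 := fun v hv => by
    have : (2 : K) • v = 0 := by rw [two_smul]; nth_rewrite 1 [hv]; simp
    simpa using this
  have μx : ∀ w, μ (Taft.gen K .x • f w) = 0 := fun w => half _ (by
    conv_lhs => rw [← μg, gx_smul, hg, map_neg])
  have μy : ∀ w, μ (Taft.gen K .y • f w) = 0 := fun w => half _ (by
    conv_lhs => rw [← μg, gy_smul, hg, map_neg])
  let ρ₀ : T →ₗ[K] (Fin n → RepP K 1 1) := LinearMap.pi fun i => RepP.ofCoord K 1 1 ∘ₗ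
    ((b.coord i ∘ₗ μ ∘ₗ Lx ∘ₗ Ly).prod ((-(b.coord i ∘ₗ μ ∘ₗ Ly)).prod
      ((b.coord i ∘ₗ μ ∘ₗ Lx).prod (b.coord i ∘ₗ μ))))
  have hρ₀ : ∀ t i, ρ₀ t i = RepP.ofCoord K 1 1 (b.coord i (μ (Taft.gen K .x • Taft.gen K .y • t)),
      -b.coord i (μ (Taft.gen K .y • t)), b.coord i (μ (Taft.gen K .x • t)),
      b.coord i (μ t)) := fun t i => by simp [ρ₀, hLx, hLy]
  let ρ : T →ₗ[Taft K] (Fin n → RepP K 1 1) := Taft.homOfGen ρ₀ (by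
    intro j t
    funext i
    rw [hρ₀, Pi.smul_apply, hρ₀]
    have hgx : μ (Taft.gen K .x • Taft.gen K .g • t) = -μ (Taft.gen K .x • t) := by
      rw [← μg (Taft.gen K .x • t), gx_smul, map_neg, neg_neg]
    have hgy : ∀ t, μ (Taft.gen K .y • Taft.gen K .g • t) = -μ (Taft.gen K .y • t) := fun t => by
      rw [← μg (Taft.gen K .y • t), gy_smul, map_neg, neg_neg]
    have hgxy : μ (Taft.gen K .x • Taft.gen K .y • Taft.gen K .g • t)
        = μ (Taft.gen K .x • Taft.gen K .y • t) := by
      rw [← μg (Taft.gen K .x • Taft.gen K .y • t), gx_smul, gy_smul, smul_neg, neg_neg]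
    have hhx : μ (Taft.gen K .x • Taft.gen K .h • t) = -μ (Taft.gen K .x • t) := by
      rw [← μh (Taft.gen K .x • t), hx_smul, map_neg, neg_neg]
    have hhy : ∀ t, μ (Taft.gen K .y • Taft.gen K .h • t) = -μ (Taft.gen K .y • t) := fun t => by
      rw [← μh (Taft.gen K .y • t), hy_smul, map_neg, neg_neg]
    have hhxy : μ (Taft.gen K .x • Taft.gen K .y • Taft.gen K .h • t)
        = μ (Taft.gen K .x • Taft.gen K .y • t) := by
      rw [← μh (Taft.gen K .x • Taft.gen K .y • t), hx_smul, hy_smul, smul_neg, neg_neg]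
    cases j
    · simp [RepP.ofCoord, smul_comm (Taft.gen K _) (_ : K), RepP.g_smul_top, gx_smul, gy_smul,
        hgx, hgy, hgxy, μg]
    · simp [RepP.ofCoord, smul_comm (Taft.gen K _) (_ : K), RepP.h_smul_top, hx_smul, hy_smul,
        hhx, hhy, hhxy, μh]
    · simp [RepP.ofCoord, smul_comm (Taft.gen K _) (_ : K), xx_smul, yx_smul]
    · simp [RepP.ofCoord, smul_comm (Taft.gen K _) (_ : K), yy_smul, yx_smul])
  have hinj : Function.Injective (ρ.comp (sumLift (fun _ => 1) fun i => f (b i))) := by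
    rw [injective_iff_map_eq_zero]
    intro q hq
    have hq' : ρ₀ (sumLift (fun _ => 1) (fun i => f (b i)) q) = 0 := hq
    rw [sumLift_apply (isEigen_one hg hh b)] at hq'
    simp only [smul_sum_basis] at hq'
    have hq2 := fun i => RepP.ofCoord_injective K 1 1
      (((hρ₀ _ i).symm.trans (congrFun hq' i)).trans (map_zero _).symm)
    have hz : ∀ w : F, (∀ i, b.coord i w = 0) → w = 0 := fun w hw => b.forall_coord_eq_zero_iff.1 hw
    obtain ⟨E, hE⟩ : ∃ E, E = b.equivFun.symm := ⟨_, rfl⟩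
    simp only [Prod.ext_iff, Prod.fst_zero, Prod.snd_zero, neg_eq_zero] at hq2
    rw [← hE] at hq2
    have ha : (fun i => (sumCoord (fun _ => 1) q i).1) = 0 := E.map_eq_zero_iff.1 (by
      simpa only [smul_add, yy_smul, xyx_smul, μxy, smul_zero, add_zero] using
        hz _ fun i => (hq2 i).1)
    have hb : (fun i => (sumCoord (fun _ => 1) q i).2.1) = 0 := E.map_eq_zero_iff.1 (by
      simpa only [smul_add, yy_smul, yx_smul, μxy, μy, map_add, map_neg, smul_zero, add_zero,
        zero_add, neg_zero, neg_eq_zero] using hz _ fun i => (hq2 i).2.1)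
    have hc : (fun i => (sumCoord (fun _ => 1) q i).2.2.1) = 0 := E.map_eq_zero_iff.1 (by
      simpa only [smul_add, xx_smul, μxy, μx, map_add, smul_zero, add_zero, zero_add] using
        hz _ fun i => (hq2 i).2.2.1)
    have hd : (fun i => (sumCoord (fun _ => 1) q i).2.2.2) = 0 := E.map_eq_zero_iff.1 (by
      simpa only [ha, hb, hc, μxy, map_zero, smul_zero, add_zero, zero_add] using
        hz _ fun i => (hq2 i).2.2.2)
    exact eq_zero_of_sumCoord ha hb hc hd
  exact ⟨ρ, (LinearMap.injective_iff_surjective (f := (ρ.comp (sumLift (fun _ => 1)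
    fun i => f (b i))).restrictScalars K)).1 hinj⟩

/-- A quotient `R` of `T` and `dim F` copies of the projective module `P` generated by invariant
vectors of the kernel make up `T` when `xy` is injective on these vectors and the dimensions
fit. -/
theorem split_of_surjective [FiniteDimensional K T] [FiniteDimensional K R]
    [FiniteDimensional K F] (f : F →ₗ[K] T)
    (hg : ∀ w, Taft.gen K .g • f w = f w) (hh : ∀ w, Taft.gen K .h • f w = f w)
    (hind : ∀ w, Taft.gen K .x • Taft.gen K .y • f w = 0 → w = 0)
    (π : T →ₗ[K] R) (hπ : ∀ i t, π (Taft.gen K i • t) = Taft.gen K i • π t)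
    (hsurj : Function.Surjective π) (hπf : ∀ w, π (f w) = 0)
    (hF : finrank K F = n) (hT : finrank K T = 4 * n + finrank K R) :
    Nonempty (T ≃ₗ[Taft K] (Fin n → RepP K 1 1) × R) := by
  let b := finBasisOfFinrankEq K F hF
  obtain ⟨ρ, hρ⟩ := exists_retraction f hg hh hind b
  refine Taft.nonempty_equiv_of_surjective (ρ.prod (Taft.homOfGen π hπ)) ?_ (by
    rw [finrank_prod, hT, finrank_sum (s := fun _ : Fin n => (1 : ℤˣ)), Fintype.card_fin])
  rintro ⟨p, r⟩
  obtain ⟨t, rfl⟩ := hsurj r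
  obtain ⟨q, hq⟩ := hρ (p - ρ t)
  refine ⟨t + sumLift (fun _ => 1) (fun i => f (b i)) q, ?_⟩
  have h0 : Taft.homOfGen π hπ (sumLift (fun _ => 1) (fun i => f (b i)) q) = 0 := by
    simp only [sumLift, RepP.lift, LinearMap.sum_apply, LinearMap.comp_apply, map_sum,
      LinearMap.toSpanSingleton_apply, map_smul, Taft.homOfGen_apply, hπf, smul_zero,
      Finset.sum_const_zero]
  rw [LinearMap.comp_apply] at hq
  refine Prod.ext ?_ ?_
  · simp [hq]
  · rw [LinearMap.prod_apply]
    change Taft.homOfGen π hπ (t + _) = π t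
    rw [map_add, h0, add_zero, Taft.homOfGen_apply]

end Splitting

/-! ### The action on tensor products -/

section Tensor

variable {K : Type*} [Field K] {M N : Type*} [AddCommGroup M] [Module K M] [Module (Taft K) M]
  [IsScalarTower K (Taft K) M] [AddCommGroup N] [Module K N] [Module (Taft K) N]
  [IsScalarTower K (Taft K) N]

/-- A pure tensor, as an element of the module `M ⊗ N`. -/
def HTensor.tmul (K : Type*) [Field K] {M N : Type*} [AddCommGroup M] [Module K M]
    [AddCommGroup N] [Module K N] (m : M) (n : N) : HTensor K M N :=
  m ⊗ₜ[K] n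

/-- The space underlying the module `M ⊗ N`. -/
def HTensor.toTensor (K : Type*) [Field K] (M N : Type*) [AddCommGroup M] [Module K M]
    [AddCommGroup N] [Module K N] : HTensor K M N ≃ₗ[K] M ⊗[K] N :=
  LinearEquiv.refl K _

omit [Module (Taft K) M] [IsScalarTower K (Taft K) M] [Module (Taft K) N]
  [IsScalarTower K (Taft K) N] in
@[simp]
theorem HTensor.toTensor_tmul (m : M) (n : N) :
    HTensor.toTensor K M N (HTensor.tmul K m n) = m ⊗ₜ[K] n := rfl

omit [Module (Taft K) M] [IsScalarTower K (Taft K) M] [Module (Taft K) N]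
  [IsScalarTower K (Taft K) N] in
theorem HTensor.ext {E : Type*} [AddCommGroup E] [Module K E] {f f' : HTensor K M N →ₗ[K] E}
    (h : ∀ m n, f (HTensor.tmul K m n) = f' (HTensor.tmul K m n)) : f = f' :=
  TensorProduct.ext' h

theorem HTensor.g_smul (m : M) (n : N) : Taft.gen K .g • HTensor.tmul K m n
    = HTensor.tmul K (Taft.gen K .g • m) (Taft.gen K .g • n) := by
  change HTensor.rep K M N (Taft.gen K .g) (m ⊗ₜ n) = _
  simp only [HTensor.rep, AlgHom.comp_apply]
  have : Bialgebra.comulAlgHom K (Taft K) (Taft.gen K .g)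
    = Taft.gen K .g ⊗ₜ Taft.gen K .g := Taft.lift_gen (Taft.comul_relations K) _
  rw [this]
  simp [HTensor.tmul, Module.endTensorEndAlgHom_apply]

theorem HTensor.h_smul (m : M) (n : N) : Taft.gen K .h • HTensor.tmul K m n
    = HTensor.tmul K (Taft.gen K .h • m) (Taft.gen K .h • n) := by
  change HTensor.rep K M N (Taft.gen K .h) (m ⊗ₜ n) = _
  simp only [HTensor.rep, AlgHom.comp_apply]
  have : Bialgebra.comulAlgHom K (Taft K) (Taft.gen K .h)
    = Taft.gen K .h ⊗ₜ Taft.gen K .h := Taft.lift_gen (Taft.comul_relations K) _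
  rw [this]
  simp [HTensor.tmul, Module.endTensorEndAlgHom_apply]

theorem HTensor.x_smul (m : M) (n : N) : Taft.gen K .x • HTensor.tmul K m n
    = HTensor.tmul K (Taft.gen K .x • m) n
      + HTensor.tmul K (Taft.gen K .g • m) (Taft.gen K .x • n) := by
  change HTensor.rep K M N (Taft.gen K .x) (m ⊗ₜ n) = _
  simp only [HTensor.rep, AlgHom.comp_apply]
  have : Bialgebra.comulAlgHom K (Taft K) (Taft.gen K .x)
    = Taft.gen K .x ⊗ₜ 1 + Taft.gen K .g ⊗ₜ Taft.gen K .x :=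
    Taft.lift_gen (Taft.comul_relations K) _
  rw [this]
  simp [HTensor.tmul, Module.endTensorEndAlgHom_apply]
  rfl

theorem HTensor.y_smul (m : M) (n : N) : Taft.gen K .y • HTensor.tmul K m n
    = HTensor.tmul K (Taft.gen K .y • m) n
      + HTensor.tmul K (Taft.gen K .h • m) (Taft.gen K .y • n) := by
  change HTensor.rep K M N (Taft.gen K .y) (m ⊗ₜ n) = _
  simp only [HTensor.rep, AlgHom.comp_apply]
  have : Bialgebra.comulAlgHom K (Taft K) (Taft.gen K .y)
    = Taft.gen K .y ⊗ₜ 1 + Taft.gen K .h ⊗ₜ Taft.gen K .y :=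
    Taft.lift_gen (Taft.comul_relations K) _
  rw [this]
  simp [HTensor.tmul, Module.endTensorEndAlgHom_apply]
  rfl

instance [FiniteDimensional K M] [FiniteDimensional K N] : FiniteDimensional K (HTensor K M N) :=
  inferInstanceAs (FiniteDimensional K (M ⊗[K] N))

omit [Module (Taft K) M] [IsScalarTower K (Taft K) M] [Module (Taft K) N]
  [IsScalarTower K (Taft K) N] in
theorem HTensor.finrank_eq : finrank K (HTensor K M N) = finrank K M * finrank K N :=
  finrank_tensorProduct

/-- The tensor product of any module with `P` is a sum of modules `P(s, s)`, one for each vector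
of a basis of eigenvectors. -/
theorem tensor_P [CharZero K] {ι : Type*} [Fintype ι] (s : ι → ℤˣ) (b : Basis ι K M)
    (hb : IsEigen K s b) :
    Nonempty (HTensor K M (RepP K 1 1) ≃ₗ[Taft K] ∀ i, RepP K (s i) (s i)) := by
  have : FiniteDimensional K M := b.finiteDimensional_of_finite
  have hgh : ∀ w : M, Taft.gen K .g • Taft.gen K .h • w = w := by
    intro w
    have : ((Algebra.lsmul K K M (Taft.gen K .g)) ∘ₗ (Algebra.lsmul K K M (Taft.gen K .h)))
        = LinearMap.id := b.ext fun i => by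
      simp only [LinearMap.comp_apply, Algebra.lsmul_coe, LinearMap.id_apply, (hb i).2,
        smul_comm (Taft.gen K .g) (_ : K), (hb i).1]
      rcases Int.units_eq_one_or (s i) with h | h <;> simp [h]
    exact LinearMap.congr_fun this w
  let τ : M →ₗ[K] HTensor K M (RepP K 1 1) :=
    (TensorProduct.mk K M (RepP K 1 1)).flip (RepP.top K 1 1)
  have hτ : ∀ w, τ w = HTensor.tmul K w (RepP.top K 1 1) := fun w => rfl
  have hm : IsEigen K s (fun i => τ (b i)) := fun i => by
    constructor
    · dsimp only
      rw [hτ, HTensor.g_smul, RepP.g_smul_top, (hb i).1, Units.val_one, Int.cast_one, one_smul]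
      exact map_smul τ _ _
    · dsimp only
      rw [hτ, HTensor.h_smul, RepP.h_smul_top, (hb i).2, Units.val_one, Int.cast_one, one_smul]
      exact map_smul τ _ _
  -- the coefficient of `xye` in the second factor
  let lam : HTensor K M (RepP K 1 1) →ₗ[K] M :=
    (TensorProduct.rid K M).toLinearMap ∘ₗ LinearMap.lTensor M (LinearMap.snd K K K ∘ₗ
      LinearMap.snd K K _ ∘ₗ LinearMap.snd K K _ ∘ₗ (RepP.equiv K 1 1).toLinearMap) ∘ₗ
      (HTensor.toTensor K M (RepP K 1 1)).toLinearMap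
  have hlam : ∀ w a, lam (HTensor.tmul K w (RepP.ofCoord K 1 1 a)) = a.2.2.2 • w := by
    intro w a
    rw [← RepP.equiv_symm_apply]
    simp [lam]
  have h1 : RepP.top K 1 1 = RepP.ofCoord K 1 1 (1, 0, 0, 0) := by simp [RepP.ofCoord]
  have hx : Taft.gen K .x • RepP.top K 1 1 = RepP.ofCoord K 1 1 (0, 1, 0, 0) := by
    simp [RepP.ofCoord]
  have hy : Taft.gen K .y • RepP.top K 1 1 = RepP.ofCoord K 1 1 (0, 0, 1, 0) := by
    simp [RepP.ofCoord]
  have hxy : Taft.gen K .x • Taft.gen K .y • RepP.top K 1 1 = RepP.ofCoord K 1 1 (0, 0, 0, 1) := by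
    simp [RepP.ofCoord]
  -- `xy (w ⊗ e)` has the component `gh w ⊗ xye`, and `gh` acts by the identity
  have key : ∀ w, lam (Taft.gen K .x • Taft.gen K .y • τ w) = w := by
    intro w
    rw [hτ, HTensor.y_smul, smul_add, HTensor.x_smul, HTensor.x_smul, hxy, hx, hy, h1]
    simp [hlam, hgh]
  have inj := coprod_sumLift_injective hm
    (0 : PUnit →ₗ[Taft K] HTensor K M (RepP K 1 1)) (Function.injective_of_subsingleton _)
    (fun c r h => by
      have h2 : ∑ i, c i • τ (b i) = τ (b.equivFun.symm c) := by simp [Basis.equivFun_symm_apply]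
      rw [h2] at h
      have := congrArg lam h
      rw [key] at this
      exact b.equivFun.symm.map_eq_zero_iff.1 (by simpa using this))
  have inj' : Function.Injective (sumLift (K := K) s fun i => τ (b i)) := by
    intro p q hpq
    exact congrArg Prod.fst (@inj (p, 0) (q, 0) (by simpa using hpq))
  obtain ⟨e⟩ := Taft.nonempty_equiv_of_injective _ inj' (by
    rw [finrank_sum, HTensor.finrank_eq, RepP.finrank_eq, finrank_eq_card_basis b, mul_comm])
  exact ⟨e.symm⟩

end Tensor

/-! ### Tensor products of two-step modules in coordinates -/

namespace TwoStep

section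

variable {K : Type*} [Field K] {U V : Type*} [AddCommGroup U] [Module K U] [AddCommGroup V]
  [Module K V] (X Y : U →ₗ[K] V)

/-- The space underlying a two-step module. -/
def equiv : TwoStep X Y ≃ₗ[K] U × V := LinearEquiv.refl K _

variable {X Y}

theorem equiv_g_smul (m : TwoStep X Y) :
    equiv X Y (Taft.gen K .g • m) = ((equiv X Y m).1, -(equiv X Y m).2) := by
  change Taft.lift (K := K) (TwoStep.relations X Y) (Taft.gen K .g) (equiv X Y m) = _
  rw [Taft.lift_gen]
  simp [Gen.val, sgn]

theorem equiv_h_smul (m : TwoStep X Y) :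
    equiv X Y (Taft.gen K .h • m) = ((equiv X Y m).1, -(equiv X Y m).2) := by
  change Taft.lift (K := K) (TwoStep.relations X Y) (Taft.gen K .h) (equiv X Y m) = _
  rw [Taft.lift_gen]
  simp [Gen.val, sgn]

theorem equiv_x_smul (m : TwoStep X Y) :
    equiv X Y (Taft.gen K .x • m) = (0, X (equiv X Y m).1) := by
  change Taft.lift (K := K) (TwoStep.relations X Y) (Taft.gen K .x) (equiv X Y m) = _
  rw [Taft.lift_gen]
  simp [Gen.val, shift]

theorem equiv_y_smul (m : TwoStep X Y) :
    equiv X Y (Taft.gen K .y • m) = (0, Y (equiv X Y m).1) := by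
  change Taft.lift (K := K) (TwoStep.relations X Y) (Taft.gen K .y) (equiv X Y m) = _
  rw [Taft.lift_gen]
  simp [Gen.val, shift]

instance [FiniteDimensional K U] [FiniteDimensional K V] : FiniteDimensional K (TwoStep X Y) :=
  Module.Finite.equiv (equiv X Y).symm

theorem finrank_eq [FiniteDimensional K U] [FiniteDimensional K V] :
    finrank K (TwoStep X Y) = finrank K U + finrank K V := by
  rw [(equiv X Y).finrank_eq, finrank_prod]

end

section Coord

variable {K : Type*} [Field K] {a b : ℕ} {U' V' : Type*} [AddCommGroup U'] [Module K U']
  [AddCommGroup V'] [Module K V']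

/-- The map `Z ⊗ E` on `Kᵃ ⊗ E`, the latter identified with `Eᵃ`. -/
def extend (Z : (Fin a → K) →ₗ[K] (Fin b → K)) (E : Type*) [AddCommGroup E] [Module K E] :
    (Fin a → E) →ₗ[K] (Fin b → E) where
  toFun F j := ∑ i, Z (Pi.single i 1) j • F i
  map_add' F G := by funext j; simp [Finset.sum_add_distrib]
  map_smul' c F := by funext j; simp [Finset.smul_sum, smul_comm c]

theorem extend_smul (Z : (Fin a → K) →ₗ[K] (Fin b → K)) {E : Type*} [AddCommGroup E] [Module K E]
    (u : Fin a → K) (w : E) : extend Z E (fun i => u i • w) = fun j => Z u j • w := by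
  funext j
  have : Z u j = ∑ i, u i * Z (Pi.single i 1) j := by
    conv_lhs => rw [← Finset.univ_sum_single u]
    rw [map_sum, Finset.sum_apply]
    refine Finset.sum_congr rfl fun i _ => ?_
    rw [show (Pi.single i (u i) : Fin a → K) = u i • Pi.single i 1 by simp [← Pi.single_smul],
      map_smul, Pi.smul_apply, smul_eq_mul]
  rw [this, Finset.sum_smul]
  simp only [extend, LinearMap.coe_mk, AddHom.coe_mk, smul_smul]
  exact Finset.sum_congr rfl fun i _ => by rw [mul_comm]

variable (X Y : (Fin a → K) →ₗ[K] (Fin b → K)) (X' Y' : U' →ₗ[K] V')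

/-- Coordinates on the tensor product of two two-step modules `U ⊕ V` and `U' ⊕ V'`, where
`U = Kᵃ` and `V = Kᵇ`: the components in `U ⊗ U'`, `V ⊗ U'`, `U ⊗ V'` and `V ⊗ V'`. -/
def coord : HTensor K (TwoStep X Y) (TwoStep X' Y') ≃ₗ[K]
    (Fin a → U') × (Fin b → U') × (Fin a → V') × (Fin b → V') :=
  HTensor.toTensor K _ _ ≪≫ₗ
  TensorProduct.congr (equiv X Y) (equiv X' Y') ≪≫ₗ
  TensorProduct.prodLeft K K (Fin a → K) (Fin b → K) (U' × V') ≪≫ₗ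
  LinearEquiv.prodCongr
    (TensorProduct.prodRight K K (Fin a → K) U' V' ≪≫ₗ LinearEquiv.prodCongr
      (TensorProduct.comm K _ _ ≪≫ₗ TensorProduct.piScalarRight K K U' (Fin a))
      (TensorProduct.comm K _ _ ≪≫ₗ TensorProduct.piScalarRight K K V' (Fin a)))
    (TensorProduct.prodRight K K (Fin b → K) U' V' ≪≫ₗ LinearEquiv.prodCongr
      (TensorProduct.comm K _ _ ≪≫ₗ TensorProduct.piScalarRight K K U' (Fin b))
      (TensorProduct.comm K _ _ ≪≫ₗ TensorProduct.piScalarRight K K V' (Fin b))) ≪≫ₗ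
  LinearEquiv.prodAssoc K _ _ _ ≪≫ₗ
  LinearEquiv.prodCongr (LinearEquiv.refl K _)
    ((LinearEquiv.prodAssoc K _ _ _).symm ≪≫ₗ
      LinearEquiv.prodCongr (LinearEquiv.prodComm K _ _) (LinearEquiv.refl K _) ≪≫ₗ
      LinearEquiv.prodAssoc K _ _ _)

variable {X Y X' Y'}

theorem coord_tmul (m : TwoStep X Y) (n : TwoStep X' Y') :
    coord X Y X' Y' (HTensor.tmul K m n) =
      (fun i => (equiv X Y m).1 i • (equiv X' Y' n).1,
       fun i => (equiv X Y m).2 i • (equiv X' Y' n).1,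
       fun i => (equiv X Y m).1 i • (equiv X' Y' n).2,
       fun i => (equiv X Y m).2 i • (equiv X' Y' n).2) := by
  obtain ⟨⟨u, v⟩, rfl⟩ := (equiv X Y).symm.surjective m
  obtain ⟨⟨u', v'⟩, rfl⟩ := (equiv X' Y').symm.surjective n
  simp only [coord, LinearEquiv.trans_apply, HTensor.toTensor_tmul, TensorProduct.congr_tmul,
    LinearEquiv.apply_symm_apply, TensorProduct.prodLeft_tmul, LinearEquiv.prodCongr_apply,
    TensorProduct.prodRight_tmul, TensorProduct.comm_tmul, TensorProduct.piScalarRight_apply,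
    TensorProduct.piScalarRightHom_tmul]
  rfl

theorem lsmul_ext {E : Type*} [AddCommGroup E] [Module K E] {c : Taft K}
    {f : HTensor K (TwoStep X Y) (TwoStep X' Y') →ₗ[K] E}
    {f' : HTensor K (TwoStep X Y) (TwoStep X' Y') →ₗ[K] E}
    (h : ∀ m n, f (c • HTensor.tmul K m n) = f' (HTensor.tmul K m n))
    (t : HTensor K (TwoStep X Y) (TwoStep X' Y')) : f (c • t) = f' t := by
  have : f ∘ₗ Algebra.lsmul K K _ c = f' := HTensor.ext h
  exact LinearMap.congr_fun this t

theorem coord_g_smul (t : HTensor K (TwoStep X Y) (TwoStep X' Y')) :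
    coord X Y X' Y' (Taft.gen K .g • t) = ((coord X Y X' Y' t).1, -(coord X Y X' Y' t).2.1,
      -(coord X Y X' Y' t).2.2.1, (coord X Y X' Y' t).2.2.2) := by
  refine lsmul_ext (f := (coord X Y X' Y').toLinearMap)
    (f' := (LinearMap.prodMap LinearMap.id (LinearMap.prodMap (-LinearMap.id)
      (LinearMap.prodMap (-LinearMap.id) LinearMap.id))) ∘ₗ (coord X Y X' Y').toLinearMap)
    (fun m n => ?_) t
  simp only [LinearMap.comp_apply, LinearEquiv.coe_coe, HTensor.g_smul, coord_tmul, equiv_g_smul,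
    LinearMap.prodMap_apply, LinearMap.neg_apply, LinearMap.id_apply]
  refine Prod.ext ?_ (Prod.ext ?_ (Prod.ext ?_ ?_)) <;> funext i <;> simp

theorem coord_h_smul (t : HTensor K (TwoStep X Y) (TwoStep X' Y')) :
    coord X Y X' Y' (Taft.gen K .h • t) = ((coord X Y X' Y' t).1, -(coord X Y X' Y' t).2.1,
      -(coord X Y X' Y' t).2.2.1, (coord X Y X' Y' t).2.2.2) := by
  refine lsmul_ext (f := (coord X Y X' Y').toLinearMap)
    (f' := (LinearMap.prodMap LinearMap.id (LinearMap.prodMap (-LinearMap.id)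
      (LinearMap.prodMap (-LinearMap.id) LinearMap.id))) ∘ₗ (coord X Y X' Y').toLinearMap)
    (fun m n => ?_) t
  simp only [LinearMap.comp_apply, LinearEquiv.coe_coe, HTensor.h_smul, coord_tmul, equiv_h_smul,
    LinearMap.prodMap_apply, LinearMap.neg_apply, LinearMap.id_apply]
  refine Prod.ext ?_ (Prod.ext ?_ (Prod.ext ?_ ?_)) <;> funext i <;> simp

/-- The action of `x` or of `y` in coordinates. The sign in the last component comes from the action
of `g` or `h` on `V`. -/
def coordAct (X : (Fin a → K) →ₗ[K] (Fin b → K)) (X' : U' →ₗ[K] V') :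
    (Fin a → U') × (Fin b → U') × (Fin a → V') × (Fin b → V') →ₗ[K]
    (Fin a → U') × (Fin b → U') × (Fin a → V') × (Fin b → V') where
  toFun w := (0, extend X U' w.1, fun i => X' (w.1 i),
    extend X V' w.2.2.1 - fun i => X' (w.2.1 i))
  map_add' v w := by
    refine Prod.ext ?_ (Prod.ext ?_ (Prod.ext ?_ ?_)) <;> funext i <;> simp
    abel
  map_smul' c w := by
    refine Prod.ext ?_ (Prod.ext ?_ (Prod.ext ?_ ?_)) <;> funext i <;> simp [smul_sub]

theorem coord_x_smul (t : HTensor K (TwoStep X Y) (TwoStep X' Y')) :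
    coord X Y X' Y' (Taft.gen K .x • t) = coordAct X X' (coord X Y X' Y' t) := by
  refine lsmul_ext (f := (coord X Y X' Y').toLinearMap)
    (f' := coordAct X X' ∘ₗ (coord X Y X' Y').toLinearMap) (fun m n => ?_) t
  simp only [LinearMap.comp_apply, LinearEquiv.coe_coe, HTensor.x_smul, map_add, coord_tmul,
    equiv_x_smul, equiv_g_smul, coordAct, LinearMap.coe_mk, AddHom.coe_mk, extend_smul]
  refine Prod.ext ?_ (Prod.ext ?_ (Prod.ext ?_ ?_)) <;> funext i <;> simp [sub_eq_add_neg]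

theorem coord_y_smul (t : HTensor K (TwoStep X Y) (TwoStep X' Y')) :
    coord X Y X' Y' (Taft.gen K .y • t) = coordAct Y Y' (coord X Y X' Y' t) := by
  refine lsmul_ext (f := (coord X Y X' Y').toLinearMap)
    (f' := coordAct Y Y' ∘ₗ (coord X Y X' Y').toLinearMap) (fun m n => ?_) t
  simp only [LinearMap.comp_apply, LinearEquiv.coe_coe, HTensor.y_smul, map_add, coord_tmul,
    equiv_y_smul, equiv_h_smul, coordAct, LinearMap.coe_mk, AddHom.coe_mk, extend_smul]
  refine Prod.ext ?_ (Prod.ext ?_ (Prod.ext ?_ ?_)) <;> funext i <;> simp [sub_eq_add_neg]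

end Coord

/-! ### The twist by the simple module `S` -/

section Twist

variable {K : Type*} [Field K] {U V : Type*} [AddCommGroup U] [Module K U] [AddCommGroup V]
  [Module K V] (X Y : U →ₗ[K] V)

theorem simple_g_smul (c : RepS K (-1) (-1)) : Taft.gen K .g • c = -c := by
  change Taft.lift (K := K) (simple_relations K (-1) (-1)) (Taft.gen K .g) c = _
  rw [Taft.lift_gen]
  change (((-1 : ℤˣ) : ℤ) : K) • c = -c
  rw [Units.val_neg, Units.val_one, Int.cast_neg, Int.cast_one, neg_one_smul]

theorem simple_h_smul (c : RepS K (-1) (-1)) : Taft.gen K .h • c = -c := by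
  change Taft.lift (K := K) (simple_relations K (-1) (-1)) (Taft.gen K .h) c = _
  rw [Taft.lift_gen]
  change (((-1 : ℤˣ) : ℤ) : K) • c = -c
  rw [Units.val_neg, Units.val_one, Int.cast_neg, Int.cast_one, neg_one_smul]

theorem simple_x_smul (c : RepS K (-1) (-1)) : Taft.gen K .x • c = 0 := by
  change Taft.lift (K := K) (simple_relations K (-1) (-1)) (Taft.gen K .x) c = _
  rw [Taft.lift_gen]
  rfl

theorem simple_y_smul (c : RepS K (-1) (-1)) : Taft.gen K .y • c = 0 := by
  change Taft.lift (K := K) (simple_relations K (-1) (-1)) (Taft.gen K .y) c = _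
  rw [Taft.lift_gen]
  rfl

/-- The basis vector of `S`. -/
def simpleOne (K : Type*) [Field K] : RepS K (-1) (-1) := (1 : K)

/-- The space underlying the twist of a two-step module by `S`. -/
def twistEquiv : HTensor K (TwoStep X Y) (RepS K (-1) (-1)) ≃ₗ[K] U × V :=
  HTensor.toTensor K _ _ ≪≫ₗ
  TensorProduct.congr (equiv X Y) (LinearEquiv.refl K K : RepS K (-1) (-1) ≃ₗ[K] K) ≪≫ₗ
  TensorProduct.rid K (U × V)

variable {X Y}

theorem twistEquiv_symm_apply (w : U × V) :
    (twistEquiv X Y).symm w = HTensor.tmul K ((equiv X Y).symm w) (simpleOne K) := rfl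

theorem g_smul_twistEquiv_symm (w : U × V) :
    Taft.gen K .g • (twistEquiv X Y).symm w = (twistEquiv X Y).symm (-w.1, w.2) := by
  rw [twistEquiv_symm_apply, HTensor.g_smul, simple_g_smul, twistEquiv_symm_apply]
  refine ((TensorProduct.tmul_neg _ _).trans (TensorProduct.neg_tmul _ _).symm).trans ?_
  change HTensor.tmul K _ _ = HTensor.tmul K _ _
  congr 1
  apply (equiv X Y).injective
  rw [map_neg, equiv_g_smul]
  simp

theorem h_smul_twistEquiv_symm (w : U × V) :
    Taft.gen K .h • (twistEquiv X Y).symm w = (twistEquiv X Y).symm (-w.1, w.2) := by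
  rw [twistEquiv_symm_apply, HTensor.h_smul, simple_h_smul, twistEquiv_symm_apply]
  refine ((TensorProduct.tmul_neg _ _).trans (TensorProduct.neg_tmul _ _).symm).trans ?_
  change HTensor.tmul K _ _ = HTensor.tmul K _ _
  congr 1
  apply (equiv X Y).injective
  rw [map_neg, equiv_h_smul]
  simp

theorem x_smul_twistEquiv_symm (w : U × V) :
    Taft.gen K .x • (twistEquiv X Y).symm w = (twistEquiv X Y).symm (0, X w.1) := by
  rw [twistEquiv_symm_apply, HTensor.x_smul, simple_x_smul, twistEquiv_symm_apply]
  refine (congrArg (fun t : HTensor K (TwoStep X Y) (RepS K (-1) (-1)) => _ + t)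
    (TensorProduct.tmul_zero _ _)).trans ((add_zero _).trans ?_)
  congr 1
  apply (equiv X Y).injective
  rw [equiv_x_smul]
  simp

theorem y_smul_twistEquiv_symm (w : U × V) :
    Taft.gen K .y • (twistEquiv X Y).symm w = (twistEquiv X Y).symm (0, Y w.1) := by
  rw [twistEquiv_symm_apply, HTensor.y_smul, simple_y_smul, twistEquiv_symm_apply]
  refine (congrArg (fun t : HTensor K (TwoStep X Y) (RepS K (-1) (-1)) => _ + t)
    (TensorProduct.tmul_zero _ _)).trans ((add_zero _).trans ?_)
  congr 1
  apply (equiv X Y).injective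
  rw [equiv_y_smul]
  simp

theorem twistEquiv_g_smul (t : HTensor K (TwoStep X Y) (RepS K (-1) (-1))) :
    twistEquiv X Y (Taft.gen K .g • t) = (-(twistEquiv X Y t).1, (twistEquiv X Y t).2) := by
  obtain ⟨w, rfl⟩ := (twistEquiv X Y).symm.surjective t
  rw [g_smul_twistEquiv_symm]; simp

theorem twistEquiv_h_smul (t : HTensor K (TwoStep X Y) (RepS K (-1) (-1))) :
    twistEquiv X Y (Taft.gen K .h • t) = (-(twistEquiv X Y t).1, (twistEquiv X Y t).2) := by
  obtain ⟨w, rfl⟩ := (twistEquiv X Y).symm.surjective t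
  rw [h_smul_twistEquiv_symm]; simp

theorem twistEquiv_x_smul (t : HTensor K (TwoStep X Y) (RepS K (-1) (-1))) :
    twistEquiv X Y (Taft.gen K .x • t) = (0, X (twistEquiv X Y t).1) := by
  obtain ⟨w, rfl⟩ := (twistEquiv X Y).symm.surjective t
  rw [x_smul_twistEquiv_symm]; simp

theorem twistEquiv_y_smul (t : HTensor K (TwoStep X Y) (RepS K (-1) (-1))) :
    twistEquiv X Y (Taft.gen K .y • t) = (0, Y (twistEquiv X Y t).1) := by
  obtain ⟨w, rfl⟩ := (twistEquiv X Y).symm.surjective t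
  rw [y_smul_twistEquiv_symm]; simp

instance [FiniteDimensional K U] [FiniteDimensional K V] :
    FiniteDimensional K (HTensor K (TwoStep X Y) (RepS K (-1) (-1))) :=
  Module.Finite.equiv (twistEquiv X Y).symm

theorem finrank_twist [FiniteDimensional K U] [FiniteDimensional K V] :
    finrank K (HTensor K (TwoStep X Y) (RepS K (-1) (-1))) = finrank K U + finrank K V := by
  rw [(twistEquiv X Y).finrank_eq, finrank_prod]

end Twist

/-! ### Criteria for splitting the tensor product of two two-step modules -/

section Criteria

variable {K : Type*} [Field K] [CharZero K] {a b n : ℕ} {U' V' : Type*} [AddCommGroup U']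
  [Module K U'] [AddCommGroup V'] [Module K V'] [FiniteDimensional K U'] [FiniteDimensional K V']
  {X Y : (Fin a → K) →ₗ[K] (Fin b → K)} {X' Y' : U' →ₗ[K] V'}

theorem finrank_fin_pi (K : Type*) [Field K] (m : ℕ) (E : Type*) [AddCommGroup E] [Module K E]
    [FiniteDimensional K E] : finrank K (Fin m → E) = m * finrank K E := by
  rw [Module.finrank_pi_fintype]; simp

omit [CharZero K] in
theorem finrank_tensor : finrank K (HTensor K (TwoStep X Y) (TwoStep X' Y'))
    = (a + b) * (finrank K U' + finrank K V') := by
  rw [HTensor.finrank_eq, finrank_eq, finrank_eq]; simp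

variable (X Y X' Y') in
/-- The action of `xy` on the tensor product of two two-step modules, as the map
`X ⊗ Y' - Y ⊗ X'` from `U ⊗ U'` to `V ⊗ V'`. -/
def socleMap : (Fin a → U') →ₗ[K] (Fin b → V') :=
  extend X V' ∘ₗ Y'.compLeft (Fin a) - X'.compLeft (Fin b) ∘ₗ extend Y U'

omit [CharZero K] [FiniteDimensional K U'] [FiniteDimensional K V'] in
theorem socleMap_apply (F : Fin a → U') : socleMap X Y X' Y' F =
    extend X V' (fun i => Y' (F i)) - fun i => X' (extend Y U' F i) := rfl

variable (X Y X' Y') in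
/-- The inclusion of `U ⊗ U'` in the tensor product of two two-step modules. -/
def topIncl : (Fin a → U') →ₗ[K] HTensor K (TwoStep X Y) (TwoStep X' Y') :=
  (coord X Y X' Y').symm.toLinearMap ∘ₗ LinearMap.inl K _ _

omit [CharZero K] [FiniteDimensional K U'] [FiniteDimensional K V'] in
theorem coord_topIncl (F : Fin a → U') : coord X Y X' Y' (topIncl X Y X' Y' F) = (F, 0) := by
  simp [topIncl]

omit [CharZero K] [FiniteDimensional K U'] [FiniteDimensional K V'] in
theorem coord_xy_topIncl (F : Fin a → U') :
    coord X Y X' Y' (Taft.gen K .x • Taft.gen K .y • topIncl X Y X' Y' F)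
      = (0, 0, 0, socleMap X Y X' Y' F) := by
  rw [coord_x_smul, coord_y_smul, coord_topIncl]
  simp only [coordAct, LinearMap.coe_mk, AddHom.coe_mk, map_zero, Pi.zero_apply]
  rfl

omit [CharZero K] [FiniteDimensional K U'] [FiniteDimensional K V'] in
theorem g_smul_topIncl (F : Fin a → U') :
    Taft.gen K .g • topIncl X Y X' Y' F = topIncl X Y X' Y' F := by
  apply (coord X Y X' Y').injective
  rw [coord_g_smul, coord_topIncl]; simp

omit [CharZero K] [FiniteDimensional K U'] [FiniteDimensional K V'] in
theorem h_smul_topIncl (F : Fin a → U') :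
    Taft.gen K .h • topIncl X Y X' Y' F = topIncl X Y X' Y' F := by
  apply (coord X Y X' Y').injective
  rw [coord_h_smul, coord_topIncl]; simp

variable {R₁ R₂ : Type*} [AddCommGroup R₁] [Module K R₁] [AddCommGroup R₂] [Module K R₂]
  [FiniteDimensional K R₁] [FiniteDimensional K R₂] {XR YR : R₁ →ₗ[K] R₂}

/-- When `X ⊗ Y' - Y ⊗ X'` is bijective, the tensor product is a sum of copies of `P`. -/
theorem split_of_bijective (hinj : ∀ F, socleMap X Y X' Y' F = 0 → F = 0)
    (hn : a * finrank K U' = n) (hT : (a + b) * (finrank K U' + finrank K V') = 4 * n) :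
    Nonempty (HTensor K (TwoStep X Y) (TwoStep X' Y') ≃ₗ[Taft K] (Fin n → RepP K 1 1)) := by
  obtain ⟨e⟩ := split_of_injective (R := PUnit) (n := n) (topIncl X Y X' Y') g_smul_topIncl
    h_smul_topIncl 0 (fun i r => by simp) (Function.injective_of_subsingleton _) (fun w r h => by
      have := coord_xy_topIncl (X := X) (Y := Y) (X' := X') (Y' := Y') w
      rw [h] at this
      simp only [LinearMap.zero_apply, map_zero, Prod.ext_iff] at this
      exact hinj w this.2.2.2.symm)
    ((finrank_fin_pi _ _ _).trans hn)
    (by rw [finrank_tensor, hT, Module.finrank_zero_of_subsingleton, add_zero])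
  exact ⟨e.trans LinearEquiv.prodUnique⟩

/-- When `X ⊗ Y' - Y ⊗ X'` is surjective, the complement of the projective summand is a submodule
`R₁ ⊕ R₂` of the tensor product: `ι₀` embeds `R₁` in `U ⊗ U'`, as the kernel of that map, and
`(δ, γ)` embeds `R₂` in `V ⊗ U' ⊕ U ⊗ V'`. The hypotheses on `X` and `Y` say that this embedding
commutes with `x` and `y`. -/
theorem split_of_kernel (ι₀ : R₁ →ₗ[K] (Fin a → U')) (δ : R₂ →ₗ[K] (Fin b → U'))
    (γ : R₂ →ₗ[K] (Fin a → V'))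
    (hX₁ : ∀ r, extend X U' (ι₀ r) = δ (XR r)) (hY₁ : ∀ r, extend Y U' (ι₀ r) = δ (YR r))
    (hX₂ : ∀ r i, X' (ι₀ r i) = γ (XR r) i) (hY₂ : ∀ r i, Y' (ι₀ r i) = γ (YR r) i)
    (hX₃ : ∀ r i, extend X V' (γ r) i = X' (δ r i)) (hY₃ : ∀ r i, extend Y V' (γ r) i = Y' (δ r i))
    (hι : ∀ r, ι₀ r = 0 → r = 0) (hδ : ∀ r, δ r = 0 → γ r = 0 → r = 0)
    (hsurj : Function.Surjective (socleMap X Y X' Y')) (hn : b * finrank K V' = n)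
    (hT : (a + b) * (finrank K U' + finrank K V') = 4 * n + (finrank K R₁ + finrank K R₂)) :
    Nonempty (HTensor K (TwoStep X Y) (TwoStep X' Y') ≃ₗ[Taft K]
      (Fin n → RepP K 1 1) × TwoStep XR YR) := by
  obtain ⟨f, hf⟩ := (socleMap X Y X' Y').exists_rightInverse_of_surjective
    (LinearMap.range_eq_top.2 hsurj)
  obtain ⟨σ, hσ⟩ : ∃ σ : TwoStep XR YR →ₗ[K] HTensor K (TwoStep X Y) (TwoStep X' Y'),
      ∀ r, coord X Y X' Y' (σ r) =
        (ι₀ (equiv XR YR r).1, δ (equiv XR YR r).2, γ (equiv XR YR r).2, 0) :=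
    ⟨(coord X Y X' Y').symm.toLinearMap ∘ₗ ((ι₀ ∘ₗ LinearMap.fst K _ _).prod
      ((δ ∘ₗ LinearMap.snd K _ _).prod ((γ ∘ₗ LinearMap.snd K _ _).prod 0))) ∘ₗ
      (equiv XR YR).toLinearMap, fun r => by simp⟩
  refine split_of_injective (topIncl X Y X' Y' ∘ₗ f)
    (fun w => by rw [LinearMap.comp_apply, g_smul_topIncl])
    (fun w => by rw [LinearMap.comp_apply, h_smul_topIncl]) σ ?_ ?_ ?_
    ((finrank_fin_pi _ _ _).trans hn) (by rw [finrank_tensor, hT, finrank_eq])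
  · intro i r
    apply (coord X Y X' Y').injective
    rw [hσ]
    cases i
    · rw [coord_g_smul, hσ, equiv_g_smul]; simp
    · rw [coord_h_smul, hσ, equiv_h_smul]; simp
    · rw [coord_x_smul, hσ, equiv_x_smul]
      refine Prod.ext ?_ (Prod.ext ?_ (Prod.ext ?_ ?_)) <;> funext i <;>
        simp [coordAct, hX₁, hX₂, hX₃]
    · rw [coord_y_smul, hσ, equiv_y_smul]
      refine Prod.ext ?_ (Prod.ext ?_ (Prod.ext ?_ ?_)) <;> funext i <;>
        simp [coordAct, hY₁, hY₂, hY₃]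
  · rw [injective_iff_map_eq_zero]
    intro r hr
    have h := hσ r
    rw [hr, map_zero] at h
    simp only [Prod.ext_iff, Prod.fst_zero, Prod.snd_zero] at h
    exact (equiv XR YR).map_eq_zero_iff.1
      (Prod.ext (hι _ h.1.symm) (hδ _ h.2.1.symm h.2.2.1.symm))
  · intro w r h
    have h2 := congrArg (coord X Y X' Y') h
    rw [LinearMap.comp_apply, coord_xy_topIncl, hσ] at h2
    simp only [Prod.ext_iff] at h2
    have := LinearMap.congr_fun hf w
    rw [LinearMap.comp_apply, h2.2.2.2] at this
    exact this.symm

/-- When `X ⊗ Y' - Y ⊗ X'` is injective, the complement of the projective summand is a quotient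
`R₁ ⊕ R₂` of the tensor product: `V ⊗ U' ⊕ U ⊗ V'` maps to `R₁` by `δ - γ`, and `V ⊗ V'` maps to
`R₂` by `-α`, which is a cokernel of `X ⊗ Y' - Y ⊗ X'`. The twist by `S` accounts for `g` and `h`
acting on `R₁` by `-1` and on `R₂` by `1`. -/
theorem split_of_cokernel (δ : (Fin b → U') →ₗ[K] R₁)
    (γ : (Fin a → V') →ₗ[K] R₁) (α : (Fin b → V') →ₗ[K] R₂)
    (hX₁ : ∀ F, δ (extend X U' F) = γ fun i => X' (F i))
    (hY₁ : ∀ F, δ (extend Y U' F) = γ fun i => Y' (F i))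
    (hX₂ : ∀ H, α (extend X V' H) = XR (γ H)) (hY₂ : ∀ H, α (extend Y V' H) = YR (γ H))
    (hX₃ : ∀ G, (α fun i => X' (G i)) = XR (δ G)) (hY₃ : ∀ G, (α fun i => Y' (G i)) = YR (δ G))
    (hδ : Function.Surjective δ) (hα : Function.Surjective α)
    (hinj : ∀ F, socleMap X Y X' Y' F = 0 → F = 0) (hn : a * finrank K U' = n)
    (hT : (a + b) * (finrank K U' + finrank K V') = 4 * n + (finrank K R₁ + finrank K R₂)) :
    Nonempty (HTensor K (TwoStep X Y) (TwoStep X' Y') ≃ₗ[Taft K]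
      (Fin n → RepP K 1 1) × HTensor K (TwoStep XR YR) (RepS K (-1) (-1))) := by
  let π₀ : (Fin a → U') × (Fin b → U') × (Fin a → V') × (Fin b → V') →ₗ[K] R₁ × R₂ :=
    (δ ∘ₗ LinearMap.fst K _ _ ∘ₗ LinearMap.snd K _ _
      - γ ∘ₗ LinearMap.fst K _ _ ∘ₗ LinearMap.snd K _ _ ∘ₗ LinearMap.snd K _ _).prod
    (-(α ∘ₗ LinearMap.snd K _ _ ∘ₗ LinearMap.snd K _ _ ∘ₗ LinearMap.snd K _ _))
  have hπ₀ : ∀ w, π₀ w = (δ w.2.1 - γ w.2.2.1, -α w.2.2.2) := fun w => rfl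
  let π : HTensor K (TwoStep X Y) (TwoStep X' Y') →ₗ[K]
      HTensor K (TwoStep XR YR) (RepS K (-1) (-1)) :=
    (twistEquiv XR YR).symm.toLinearMap ∘ₗ π₀ ∘ₗ (coord X Y X' Y').toLinearMap
  have hπ : ∀ t, π t = (twistEquiv XR YR).symm (π₀ (coord X Y X' Y' t)) := fun t => rfl
  refine split_of_surjective (topIncl X Y X' Y') g_smul_topIncl h_smul_topIncl ?_ π ?_ ?_ ?_
    ((finrank_fin_pi _ _ _).trans hn) (by rw [finrank_tensor, hT, finrank_twist])
  · intro w h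
    have := coord_xy_topIncl (X := X) (Y := Y) (X' := X') (Y' := Y') w
    rw [h] at this
    simp only [map_zero, Prod.ext_iff] at this
    exact hinj w this.2.2.2.symm
  · intro i t
    rw [hπ, hπ]
    cases i
    · rw [g_smul_twistEquiv_symm, coord_g_smul]
      simp only [hπ₀, map_neg]
      congr 2
      abel
    · rw [h_smul_twistEquiv_symm, coord_h_smul]
      simp only [hπ₀, map_neg]
      congr 2
      abel
    · rw [x_smul_twistEquiv_symm, coord_x_smul]
      simp only [hπ₀, coordAct, LinearMap.coe_mk, AddHom.coe_mk, map_sub, hX₁, hX₂, hX₃, sub_self,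
        neg_sub]
    · rw [y_smul_twistEquiv_symm, coord_y_smul]
      simp only [hπ₀, coordAct, LinearMap.coe_mk, AddHom.coe_mk, map_sub, hY₁, hY₂, hY₃, sub_self,
        neg_sub]
  · intro r
    obtain ⟨⟨r₁, r₂⟩, rfl⟩ := (twistEquiv XR YR).symm.surjective r
    obtain ⟨G, hG⟩ := hδ r₁
    obtain ⟨L, hL⟩ := hα (-r₂)
    refine ⟨(coord X Y X' Y').symm (0, G, 0, L), ?_⟩
    rw [hπ, LinearEquiv.apply_symm_apply, hπ₀]
    simp [hG, hL]
  · intro w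
    rw [hπ, coord_topIncl, hπ₀]
    simp

end Criteria

end TwoStep

/-! ### Finite sequences and the structure maps of the string modules -/

section Seq

variable {K : Type*} [Field K] {E E' : Type*} [AddCommGroup E] [Module K E] [AddCommGroup E']
  [Module K E'] {m n : ℕ}

/-- The `k`-th entry of a finite sequence numbered from `0`, extended by zero. -/
def seq (F : Fin n → E) (k : ℕ) : E := if h : k < n then F ⟨k, h⟩ else 0

omit [Module K E] in
theorem seq_val (F : Fin n → E) (i : Fin n) : seq F i = F i := by simp [seq]

omit [Module K E] in
theorem seq_of_le {F : Fin n → E} {k : ℕ} (h : n ≤ k) : seq F k = 0 := by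
  simp [seq, not_lt.2 h]

omit [Module K E] in
theorem seq_mk (p : ℕ → E) (k : ℕ) : seq (fun j : Fin n => p j) k = if k < n then p k else 0 := by
  simp [seq]

theorem seq_map (f : E →ₗ[K] E') (F : Fin n → E) (k : ℕ) :
    seq (fun i => f (F i)) k = f (seq F k) := by
  unfold seq; split_ifs <;> simp

omit [Module K E] in
theorem eq_zero_of_seq {F : Fin n → E} (h : ∀ k, seq F k = 0) : F = 0 := by
  funext i; rw [← seq_val F i, h]; rfl

omit [Module K E] in
theorem eq_zero_of_seq_succ {F : Fin n → E} (h : ∀ k < n, seq F (k + 1) = 0 → seq F k = 0) :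
    F = 0 := by
  have : ∀ d, seq F (n - d) = 0 := by
    intro d
    induction d with
    | zero => exact seq_of_le le_rfl
    | succ d ih =>
      rcases Nat.lt_or_ge d n with hd | hd
      · refine h _ (by omega) ?_
        rwa [show n - (d + 1) + 1 = n - d by omega]
      · rwa [show n - (d + 1) = n - d by omega]
  refine eq_zero_of_seq fun k => ?_
  rcases Nat.lt_or_ge k n with hk | hk
  · simpa [show n - (n - k) = k by omega] using this (n - k)
  · exact seq_of_le hk

omit [Module K E] in
theorem seq_add (F G : Fin n → E) (k : ℕ) : seq (F + G) k = seq F k + seq G k := by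
  unfold seq; split_ifs <;> simp

theorem seq_smul (c : K) (F : Fin n → E) (k : ℕ) : seq (c • F) k = c • seq F k := by
  unfold seq; split_ifs <;> simp

theorem sum_ite_smul (F : Fin m → E) (k : ℕ) :
    ∑ i : Fin m, (if (i : ℕ) = k then (1 : K) else 0) • F i = seq F k := by
  unfold seq
  split_ifs with h
  · rw [Finset.sum_eq_single ⟨k, h⟩]
    · simp
    · intro i _ hi
      rw [if_neg (fun h' => hi (Fin.ext h')), zero_smul]
    · simp
  · refine Finset.sum_eq_zero fun i _ => ?_
    rw [if_neg (fun h' => h (by have := i.2; omega)), zero_smul]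

variable (K)

/-- `u_i ↦ v_i` on bases numbered from `1`, with `v_i = 0` for `i > n`. -/
abbrev same (m n : ℕ) : (Fin m → K) →ₗ[K] (Fin n → K) := onBasis K m n fun i => bv K n i

/-- `u_i ↦ v_{i+1}` on bases numbered from `1`, with `v_i = 0` for `i > n`. -/
abbrev up (m n : ℕ) : (Fin m → K) →ₗ[K] (Fin n → K) := onBasis K m n fun i => bv K n (i + 1)

/-- `u_i ↦ v_{i-1}` on bases numbered from `1`, with `v_0 = 0` and `v_i = 0` for `i > n`. -/
abbrev down (m n : ℕ) : (Fin m → K) →ₗ[K] (Fin n → K) := onBasis K m n fun i => bv K n (i - 1)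

variable {K}

theorem onBasis_single (f : ℕ → Fin n → K) (i : Fin m) :
    onBasis K m n f (Pi.single i 1) = f (i + 1) := by
  have := (Pi.basisFun K (Fin m)).constr_basis K (fun i => f ((i : ℕ) + 1)) i
  rwa [Pi.basisFun_apply] at this

open TwoStep

theorem extend_onBasis (f : ℕ → Fin n → K) (F : Fin m → E) (j : Fin n) :
    extend (onBasis K m n f) E F j = ∑ i : Fin m, f (i + 1) j • F i := by
  simp [extend, onBasis_single]

theorem extend_same (F : Fin m → E) : extend (same K m n) E F = fun j : Fin n => seq F j := by
  funext j
  rw [extend_onBasis, ← sum_ite_smul (K := K)]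
  simp only [bv, Nat.add_right_cancel_iff, eq_comm]

theorem extend_down (F : Fin m → E) : extend (down K m n) E F = fun j : Fin n => seq F (j + 1) := by
  funext j
  rw [extend_onBasis, ← sum_ite_smul (K := K)]
  simp only [bv, Nat.add_sub_cancel, eq_comm]

theorem extend_up (F : Fin m → E) :
    extend (up K m n) E F = fun j : Fin n => if (j : ℕ) = 0 then 0 else seq F (j - 1) := by
  funext j
  rw [extend_onBasis]
  split_ifs with h
  · refine Finset.sum_eq_zero fun i _ => ?_
    rw [bv, if_neg (by omega), zero_smul]
  · rw [← sum_ite_smul (K := K)]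
    refine Finset.sum_congr rfl fun i _ => ?_
    rw [bv]
    congr 2
    exact propext ⟨fun h => by omega, fun h => by omega⟩

theorem extend_self (Z : (Fin m → K) →ₗ[K] (Fin n → K)) (f : Fin m → K) : extend Z K f = Z f := by
  simpa using extend_smul Z f (1 : K)

theorem same_apply (f : Fin m → K) : same K m n f = fun j : Fin n => seq f j := by
  rw [← extend_self, extend_same]

theorem down_apply (f : Fin m → K) : down K m n f = fun j : Fin n => seq f (j + 1) := by
  rw [← extend_self, extend_down]

theorem up_apply (f : Fin m → K) :
    up K m n f = fun j : Fin n => if (j : ℕ) = 0 then 0 else seq f (j - 1) := by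
  rw [← extend_self, extend_up]

theorem same_injective (h : m ≤ n) : Function.Injective (same K m n) := by
  rw [injective_iff_map_eq_zero]
  intro f hf
  funext i
  have := congrFun hf ⟨i, i.2.trans_le h⟩
  rw [same_apply] at this
  exact (seq_val f i).symm.trans this

theorem same_surjective (h : n ≤ m) : Function.Surjective (same K m n) := fun g => by
  refine ⟨fun i => seq g i, ?_⟩
  funext j
  rw [same_apply]
  exact (seq_mk (fun k => seq g k) j).trans ((if_pos (j.2.trans_le h)).trans (seq_val g j))

end Seq

/-! ### Tensor products with `M(r)` -/

namespace TwoStep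

section WithM

variable {K : Type*} [Field K] {r : ℕ} {U' V' : Type*} [AddCommGroup U']
  [Module K U'] [AddCommGroup V'] [Module K V'] {X' Y' : U' →ₗ[K] V'}

theorem socleMap_M (F : Fin r → U') {k : ℕ} (hk : k ≤ r) :
    socleMap (same K r (r + 1)) (up K r (r + 1)) X' Y' F ⟨k, by omega⟩
      = Y' (seq F k) - X' (if k = 0 then 0 else seq F (k - 1)) := by
  rw [socleMap_apply, extend_same, extend_up]
  simp only [Pi.sub_apply, seq_map]

theorem socleMap_M_injective (h : Function.Injective X' ∨ Function.Injective Y')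
    (F : Fin r → U') (hF : socleMap (same K r (r + 1)) (up K r (r + 1)) X' Y' F = 0) : F = 0 := by
  have key : ∀ k ≤ r, Y' (seq F k) = X' (if k = 0 then 0 else seq F (k - 1)) := fun k hk => by
    have := congrFun hF ⟨k, by omega⟩
    rw [socleMap_M F hk] at this
    exact sub_eq_zero.1 this
  rcases h with h | h
  · -- the entries vanish one after the other, starting from the last one
    refine eq_zero_of_seq_succ fun k hk hk' => ?_
    have := key (k + 1) hk
    rw [hk', map_zero, if_neg (by omega), Nat.add_sub_cancel] at this
    exact h (this.symm.trans (map_zero X').symm)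
  · refine eq_zero_of_seq fun k => ?_
    induction k with
    | zero => rw [← h.eq_iff, key 0 (by omega)]; simp
    | succ k ih =>
      rcases Nat.lt_or_ge k r with hk | hk
      · rw [← h.eq_iff, key _ hk]; simp [ih]
      · exact seq_of_le (by omega)

variable [CharZero K] [FiniteDimensional K U'] [FiniteDimensional K V']
  {R₁ R₂ : Type*} [AddCommGroup R₁] [Module K R₁] [AddCommGroup R₂] [Module K R₂]
  [FiniteDimensional K R₁] [FiniteDimensional K R₂] {XR YR : R₁ →ₗ[K] R₂}

/-- The sum of the maps `f i` on the entries of a sequence. -/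
def sumMap {E E' : Type*} [AddCommGroup E] [Module K E] [AddCommGroup E'] [Module K E'] (n : ℕ)
    (f : ℕ → E →ₗ[K] E') : (Fin n → E) →ₗ[K] E' := ∑ i : Fin n, f i ∘ₗ LinearMap.proj i

omit [CharZero K] in
theorem sumMap_apply {E E' : Type*} [AddCommGroup E] [Module K E] [AddCommGroup E'] [Module K E']
    (n : ℕ) (f : ℕ → E →ₗ[K] E') (F : Fin n → E) : sumMap n f F = ∑ i : Fin n, f i (F i) := by
  simp [sumMap]

omit [CharZero K] in
theorem sumMap_single {E E' : Type*} [AddCommGroup E] [Module K E] [AddCommGroup E'] [Module K E']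
    {n : ℕ} (f : ℕ → E →ₗ[K] E') (i : Fin n) (w : E) : sumMap n f (Pi.single i w) = f i w := by
  rw [sumMap_apply, Finset.sum_eq_single i]
  · simp
  · intro j _ hj; simp [hj]
  · simp

omit [CharZero K] in
theorem sumMap_surjective {E E' : Type*} [AddCommGroup E] [Module K E] [AddCommGroup E']
    [Module K E'] {n : ℕ} (f : ℕ → E →ₗ[K] E') {i : ℕ} (hi : i < n)
    (h : Function.Surjective (f i)) : Function.Surjective (sumMap n f) := fun w => by
  obtain ⟨v, rfl⟩ := h w
  exact ⟨Pi.single ⟨i, hi⟩ v, sumMap_single f ⟨i, hi⟩ v⟩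

omit [CharZero K] in
theorem sumMap_extend_same {E E' : Type*} [AddCommGroup E] [Module K E] [AddCommGroup E']
    [Module K E'] (f : ℕ → E →ₗ[K] E') (F : Fin r → E) :
    sumMap (r + 1) f (extend (same K r (r + 1)) E F) = ∑ i : Fin r, f i (F i) := by
  rw [sumMap_apply, extend_same, Fin.sum_univ_castSucc]
  simp [seq]

omit [CharZero K] in
theorem sumMap_extend_up {E E' : Type*} [AddCommGroup E] [Module K E] [AddCommGroup E']
    [Module K E'] (f : ℕ → E →ₗ[K] E') (F : Fin r → E) :
    sumMap (r + 1) f (extend (up K r (r + 1)) E F) = ∑ i : Fin r, f (i + 1) (F i) := by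
  rw [sumMap_apply, extend_up, Fin.sum_univ_succ]
  simp [seq]

/-- The cokernel criterion for the first factor `M(r)`, in terms of the components of the maps. -/
theorem M_tensor (δ : ℕ → U' →ₗ[K] R₁) (γ : ℕ → V' →ₗ[K] R₁) (α : ℕ → V' →ₗ[K] R₂)
    (hX₁ : ∀ i < r, δ i = γ i ∘ₗ X') (hY₁ : ∀ i < r, δ (i + 1) = γ i ∘ₗ Y')
    (hX₂ : ∀ i < r, α i = XR ∘ₗ γ i) (hY₂ : ∀ i < r, α (i + 1) = YR ∘ₗ γ i)
    (hX₃ : ∀ i ≤ r, α i ∘ₗ X' = XR ∘ₗ δ i) (hY₃ : ∀ i ≤ r, α i ∘ₗ Y' = YR ∘ₗ δ i)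
    (hδ : Function.Surjective (sumMap (r + 1) δ)) (hα : Function.Surjective (sumMap (r + 1) α))
    (hinj : ∀ F, socleMap (same K r (r + 1)) (up K r (r + 1)) X' Y' F = 0 → F = 0) {n : ℕ}
    (hn : r * finrank K U' = n)
    (hT : (r + (r + 1)) * (finrank K U' + finrank K V') = 4 * n + (finrank K R₁ + finrank K R₂)) :
    Nonempty (HTensor K (RepM K r) (TwoStep X' Y') ≃ₗ[Taft K]
      (Fin n → RepP K 1 1) × HTensor K (TwoStep XR YR) (RepS K (-1) (-1))) := by
  refine split_of_cokernel (sumMap (r + 1) δ) (sumMap r γ) (sumMap (r + 1) α) ?_ ?_ ?_ ?_ ?_ ?_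
    hδ hα hinj hn hT
  · intro F
    rw [sumMap_extend_same, sumMap_apply]
    exact Finset.sum_congr rfl fun i _ => by rw [hX₁ i i.2]; rfl
  · intro F
    rw [sumMap_extend_up, sumMap_apply]
    exact Finset.sum_congr rfl fun i _ => by rw [hY₁ i i.2]; rfl
  · intro F
    rw [sumMap_extend_same, sumMap_apply, map_sum]
    exact Finset.sum_congr rfl fun i _ => by rw [hX₂ i i.2]; rfl
  · intro F
    rw [sumMap_extend_up, sumMap_apply, map_sum]
    exact Finset.sum_congr rfl fun i _ => by rw [hY₂ i i.2]; rfl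
  · intro F
    rw [sumMap_apply, sumMap_apply, map_sum]
    exact Finset.sum_congr rfl fun i _ => LinearMap.congr_fun (hX₃ i (by omega)) (F i)
  · intro F
    rw [sumMap_apply, sumMap_apply, map_sum]
    exact Finset.sum_congr rfl fun i _ => LinearMap.congr_fun (hY₃ i (by omega)) (F i)

/-- The tensor product of `M(r)` with a band module or a string module of even dimension: the
quotient map to the twist of the second factor applies `X^(r-i) Y^i` to the `i`-th entry and sums
up. -/
theorem M_tensor_commuting {s : ℕ} {X Y : (Fin s → K) →ₗ[K] (Fin s → K)} (hXY : Commute X Y)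
    (h : Function.Bijective X ∨ Function.Bijective Y) :
    Nonempty (HTensor K (RepM K r) (TwoStep X Y) ≃ₗ[Taft K]
      (Fin (r * s) → RepP K 1 1) × HTensor K (TwoStep X Y) (RepS K (-1) (-1))) := by
  have hsurj : Function.Surjective (sumMap (r + 1) fun i => X ^ (r - i) * Y ^ i) := by
    rcases h with h | h
    · refine sumMap_surjective _ (i := 0) (by omega) ?_
      simpa [Module.End.coe_pow] using h.2.iterate r
    · refine sumMap_surjective _ (i := r) (by omega) ?_
      simpa [Module.End.coe_pow] using h.2.iterate r
  have hYX : ∀ i j, Y * (X ^ i * Y ^ j) = X ^ i * Y ^ (j + 1) := fun i j => by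
    rw [← mul_assoc, (hXY.symm.pow_right i).eq, mul_assoc, pow_succ']
  have hX : ∀ i j, X ^ i * Y ^ j * X = X ^ (i + 1) * Y ^ j := fun i j => by
    rw [mul_assoc, ← (hXY.pow_right j).eq, ← mul_assoc, pow_succ]
  refine M_tensor (fun i => X ^ (r - i) * Y ^ i) (fun i => X ^ (r - 1 - i) * Y ^ i)
    (fun i => X ^ (r - i) * Y ^ i) ?_ ?_ ?_ ?_ ?_ ?_ hsurj hsurj
    (socleMap_M_injective (h.imp (fun h => h.1) fun h => h.1)) (by simp) (by simp; ring)
  · intro i hi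
    rw [← Module.End.mul_eq_comp, hX, show r - i = r - 1 - i + 1 by omega]
  · intro i hi
    rw [← Module.End.mul_eq_comp, mul_assoc, ← pow_succ, show r - (i + 1) = r - 1 - i by omega]
  · intro i hi
    rw [← Module.End.mul_eq_comp, ← mul_assoc, ← pow_succ', show r - i = r - 1 - i + 1 by omega]
  · intro i hi
    rw [← Module.End.mul_eq_comp, hYX, show r - (i + 1) = r - 1 - i by omega]
  · intro i hi
    rw [← Module.End.mul_eq_comp, ← Module.End.mul_eq_comp, hX, ← mul_assoc, pow_succ']
  · intro i hi
    rw [← Module.End.mul_eq_comp, ← Module.End.mul_eq_comp, hYX, mul_assoc, pow_succ]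

/-- The map sending `v_k` to `v_{k+i}`. -/
def shiftUp (K : Type*) [Field K] (m n i : ℕ) : (Fin m → K) →ₗ[K] (Fin n → K) where
  toFun f k := if i ≤ (k : ℕ) then seq f (k - i) else 0
  map_add' f g := by funext k; simp only [seq_add, Pi.add_apply]; split_ifs <;> simp
  map_smul' c f := by funext k; simp only [seq_smul, Pi.smul_apply]; split_ifs <;> simp

/-- The map sending `v_{k+i}` to `v_k`. -/
def shiftDown (K : Type*) [Field K] (m n i : ℕ) : (Fin m → K) →ₗ[K] (Fin n → K) where
  toFun f k := seq f (k + i)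
  map_add' f g := by funext k; simp only [seq_add, Pi.add_apply]
  map_smul' c f := by funext k; simp only [seq_smul, Pi.smul_apply, RingHom.id_apply]

omit [CharZero K] in
theorem shiftUp_apply {m n i : ℕ} (f : Fin m → K) :
    shiftUp K m n i f = fun k : Fin n => if i ≤ k then seq f (k - i) else 0 := rfl

omit [CharZero K] in
theorem shiftDown_apply {m n i : ℕ} (f : Fin m → K) :
    shiftDown K m n i f = fun k : Fin n => seq f (k + i) := rfl

omit [CharZero K] in
theorem sumMap_shiftUp_surjective {m n : ℕ} (hm : 0 < m) (hn : n ≤ r + m) :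
    Function.Surjective (sumMap (r + 1) (shiftUp K m n)) := by
  rw [← LinearMap.range_eq_top, eq_top_iff, ← (Pi.basisFun K (Fin n)).span_eq, Submodule.span_le]
  rintro _ ⟨k, rfl⟩
  -- `v_k` is the image of a basis vector of the first row or of the last column
  obtain ⟨i, t, hi, ht, hk⟩ : ∃ i t : ℕ, i < r + 1 ∧ t < m ∧ i + t = k := by
    rcases Nat.lt_or_ge k m with h | h
    · exact ⟨0, k, by omega, h, by omega⟩
    · exact ⟨k - (m - 1), m - 1, by omega, by omega, by omega⟩
  refine ⟨Pi.single ⟨i, hi⟩ (Pi.single ⟨t, ht⟩ 1), ?_⟩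
  rw [sumMap_single, shiftUp_apply, Pi.basisFun_apply]
  funext j
  simp only [seq, Pi.single_apply, Fin.ext_iff]
  split_ifs <;> first | rfl | omega

/-- The quotient map to the twist of `M(r + s)` adds the indices of basis vectors. -/
theorem M_tensor_M {s : ℕ} (hs : 0 < s) :
    Nonempty (HTensor K (RepM K r) (RepM K s) ≃ₗ[Taft K]
      (Fin (r * s) → RepP K 1 1) × HTensor K (RepM K (r + s)) (RepS K (-1) (-1))) := by
  refine M_tensor (shiftUp K s (r + s)) (shiftUp K (s + 1) (r + s))
    (shiftUp K (s + 1) (r + s + 1)) ?_ ?_ ?_ ?_ ?_ ?_ (sumMap_shiftUp_surjective hs le_rfl)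
    (sumMap_shiftUp_surjective (by omega) (by omega))
    (socleMap_M_injective (.inl (same_injective (by omega)))) (by simp) (by simp; ring)
  all_goals
    intro i hi
    refine LinearMap.ext fun f => ?_
    funext k
    simp only [LinearMap.comp_apply, shiftUp_apply, same_apply, up_apply]
    simp only [seq]
    grind

end WithM

section MTensorW

variable {K : Type*} [Field K] {r s : ℕ}

/-- The kernel of `X ⊗ Y' - Y ⊗ X'` on `M(r) ⊗ W(s)` consists of the arrays which are constant on
diagonals, so that an element of it is determined by its first column; this column vanishes from
the entry `r - s` on. -/
theorem socleMap_M_W_eq_zero (F : Fin r → Fin (s + 1) → K)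
    (hF : socleMap (same K r (r + 1)) (up K r (r + 1)) (same K (s + 1) s) (down K (s + 1) s) F = 0)
    (h0 : ∀ k < r - s, seq (seq F k) 0 = 0) : F = 0 := by
  have key : ∀ k ≤ r, ∀ j < s, seq (seq F k) (j + 1)
      = if k = 0 then 0 else seq (seq F (k - 1)) j := fun k hk j hj => by
    have := congrFun (congrFun hF ⟨k, by omega⟩) ⟨j, hj⟩
    rw [socleMap_M F hk, down_apply, same_apply] at this
    have h2 := sub_eq_zero.1 this
    dsimp only at h2
    rw [h2]
    split_ifs
    · simp [seq]
    · rfl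
  have zero : ∀ k j, r ≤ k → seq (seq F k) j = 0 := fun k j hk => by
    rw [seq_of_le hk]; simp [seq]
  -- following a diagonal downwards leads to a row of index `r`, outside of the array
  have down : ∀ j ≤ s, ∀ k, r - k ≤ s - j → seq (seq F k) j = 0 := by
    intro j hj
    obtain ⟨d, hd⟩ : ∃ d, d = s - j := ⟨_, rfl⟩
    induction d generalizing j with
    | zero => intro k hk; exact zero k j (by omega)
    | succ d ih =>
      intro k hk
      rcases Nat.lt_or_ge k r with h | h
      · have := key (k + 1) (by omega) j (by omega)
        rw [ih (j + 1) (by omega) (by omega) (k + 1) (by omega)] at this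
        simpa using this.symm
      · exact zero k j h
  have all : ∀ j ≤ s, ∀ k, seq (seq F k) j = 0 := by
    intro j
    induction j with
    | zero =>
      intro _ k
      rcases Nat.lt_or_ge k (r - s) with h | h
      · exact h0 k h
      · exact down 0 (by omega) k (by omega)
    | succ j ih =>
      intro hj k
      rcases Nat.lt_or_ge k r with h | h
      · rw [key k h.le j (by omega)]
        split_ifs
        · rfl
        · exact ih (by omega) _
      · exact zero k _ h
  refine eq_zero_of_seq fun k => eq_zero_of_seq fun j => ?_
  rcases Nat.lt_or_ge j (s + 1) with h | h
  · exact all j (by omega) k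
  · exact seq_of_le h

/-- The bound on the kernel from `socleMap_M_W_eq_zero` makes the map surjective for reasons of
dimension. -/
theorem socleMap_M_W_surjective (h : s ≤ r) : Function.Surjective
    (socleMap (same K r (r + 1)) (up K r (r + 1)) (same K (s + 1) s) (down K (s + 1) s)) := by
  set D := socleMap (same K r (r + 1)) (up K r (r + 1)) (same K (s + 1) s) (down K (s + 1) s)
    with hD
  -- the kernel is at most `(r - s)`-dimensional
  let p : (Fin r → Fin (s + 1) → K) →ₗ[K] (Fin (r - s) → K) :=
    LinearMap.pi fun k => LinearMap.proj 0 ∘ₗ LinearMap.proj (⟨k, by omega⟩ : Fin r)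
  have hp : ∀ F k, p F k = F ⟨k, by omega⟩ 0 := fun F k => rfl
  have hker : finrank K (LinearMap.ker D) ≤ r - s := by
    have hinj : Function.Injective (p ∘ₗ (LinearMap.ker D).subtype) := by
      rw [injective_iff_map_eq_zero]
      rintro ⟨F, hF⟩ h0
      refine Subtype.ext (socleMap_M_W_eq_zero F hF fun k hk => ?_)
      have := congrFun h0 ⟨k, hk⟩
      simp only [LinearMap.comp_apply, Submodule.subtype_apply, hp, Pi.zero_apply] at this
      simpa [seq, show k < r by omega] using this
    simpa using LinearMap.finrank_le_finrank_of_injective hinj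
  have h1 := D.finrank_range_add_finrank_ker
  rw [← LinearMap.range_eq_top]
  apply Submodule.eq_top_of_finrank_eq
  have h2 := Submodule.finrank_le (LinearMap.range D)
  simp only [finrank_fin_pi, finrank_self, mul_one] at h1 h2 ⊢
  obtain ⟨d, rfl⟩ := Nat.exists_eq_add_of_le h
  rw [Nat.add_sub_cancel_left] at hker
  have h3 : (s + d) * (s + 1) = (s + d + 1) * s + d := by ring
  omega

variable [CharZero K]

omit [CharZero K] in
theorem shiftDown_zero_surjective {m n : ℕ} (h : n ≤ m) :
    Function.Surjective (shiftDown K m n 0) := fun g => by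
  obtain ⟨f, rfl⟩ := same_surjective h g
  exact ⟨f, by rw [same_apply, shiftDown_apply]; rfl⟩

/-- The quotient map to the twist of `W(s - r)` subtracts the index of the basis vector in `M(r)`
from the one in `W(s)`. -/
theorem M_tensor_W_of_le (h : r ≤ s) :
    Nonempty (HTensor K (RepM K r) (RepW K s) ≃ₗ[Taft K]
      (Fin (r * (s + 1)) → RepP K 1 1) × HTensor K (RepW K (s - r)) (RepS K (-1) (-1))) := by
  refine M_tensor (shiftDown K (s + 1) (s - r + 1)) (shiftDown K s (s - r + 1))
    (shiftDown K s (s - r)) ?_ ?_ ?_ ?_ ?_ ?_ ?_ ?_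
    (fun F hF => socleMap_M_W_eq_zero F hF (by omega)) (by simp) ?_
  · intro i hi
    refine LinearMap.ext fun f => ?_
    funext k
    simp only [LinearMap.comp_apply, shiftDown_apply, same_apply]
    simp only [seq]
    grind
  · intro i hi
    refine LinearMap.ext fun f => ?_
    funext k
    simp only [LinearMap.comp_apply, shiftDown_apply, down_apply]
    simp only [seq]
    grind
  · intro i hi
    refine LinearMap.ext fun f => ?_
    funext k
    simp only [LinearMap.comp_apply, shiftDown_apply, same_apply]
    simp only [seq]
    grind
  · intro i hi
    refine LinearMap.ext fun f => ?_
    funext k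
    simp only [LinearMap.comp_apply, shiftDown_apply, down_apply]
    simp only [seq]
    grind
  · intro i hi
    refine LinearMap.ext fun f => ?_
    funext k
    simp only [LinearMap.comp_apply, shiftDown_apply, same_apply]
    simp only [seq]
    grind
  · intro i hi
    refine LinearMap.ext fun f => ?_
    funext k
    simp only [LinearMap.comp_apply, shiftDown_apply, down_apply]
    simp only [seq]
    grind
  · exact sumMap_surjective _ (i := 0) (by omega) (shiftDown_zero_surjective (by omega))
  · exact sumMap_surjective _ (i := 0) (by omega) (shiftDown_zero_surjective (by omega))
  · simp only [finrank_fin_pi, finrank_self, mul_one]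
    obtain ⟨d, rfl⟩ := Nat.exists_eq_add_of_le h
    rw [Nat.add_sub_cancel_left]
    ring

/-- The matrix constant on the diagonals whose first column is the given sequence. -/
def diagonals (K : Type*) [Field K] (n a c : ℕ) : (Fin n → K) →ₗ[K] (Fin a → Fin c → K) where
  toFun f i j := if (j : ℕ) ≤ i then seq f (i - j) else 0
  map_add' f g := by funext i j; simp only [seq_add, Pi.add_apply]; split_ifs <;> simp
  map_smul' c f := by funext i j; simp only [seq_smul, Pi.smul_apply]; split_ifs <;> simp

omit [CharZero K] in
theorem diagonals_apply {n a c : ℕ} (f : Fin n → K) : diagonals K n a c f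
    = fun (i : Fin a) (j : Fin c) => if (j : ℕ) ≤ i then seq f (i - j) else 0 := rfl

omit [CharZero K] in
theorem eq_zero_of_diagonals {n a c : ℕ} (hn : n ≤ a) (hc : 0 < c) (f : Fin n → K)
    (hf : diagonals K n a c f = 0) : f = 0 := by
  funext i
  have := congrFun (congrFun hf ⟨i, by omega⟩) ⟨0, hc⟩
  simpa [diagonals_apply, seq_val] using this

/-- The submodule `M(r - s)` consists of the arrays which are constant on diagonals. -/
theorem M_tensor_W_of_lt (h : s < r) :
    Nonempty (HTensor K (RepM K r) (RepW K s) ≃ₗ[Taft K]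
      (Fin ((r + 1) * s) → RepP K 1 1) × RepM K (r - s)) := by
  refine split_of_kernel (diagonals K (r - s) r (s + 1)) (diagonals K (r - s + 1) (r + 1) (s + 1))
    (diagonals K (r - s + 1) r s) ?_ ?_ ?_ ?_ ?_ ?_
    (eq_zero_of_diagonals (by omega) (by omega))
    (fun f hf _ => eq_zero_of_diagonals (by omega) (by omega) f hf)
    (socleMap_M_W_surjective h.le) (by simp) ?_
  · intro f
    funext i j
    simp only [extend_same, diagonals_apply, same_apply]
    simp only [seq, dite_apply, Pi.zero_apply]
    grind
  · intro f
    funext i j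
    simp only [extend_up, diagonals_apply, up_apply]
    simp only [seq, dite_apply, ite_apply, Pi.zero_apply]
    grind
  · intro f i
    funext j
    simp only [diagonals_apply, same_apply]
    simp only [seq]
    grind
  · intro f i
    funext j
    simp only [diagonals_apply, up_apply, down_apply]
    simp only [seq]
    grind
  · intro f i
    funext j
    simp only [extend_same, diagonals_apply, same_apply]
    simp only [seq, dite_apply, Pi.zero_apply]
    grind
  · intro f i
    funext j
    simp only [extend_up, diagonals_apply, down_apply]
    simp only [seq, dite_apply, ite_apply, Pi.zero_apply]
    grind
  · simp only [finrank_fin_pi, finrank_self, mul_one]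
    obtain ⟨d, rfl⟩ := Nat.exists_eq_add_of_le h.le
    rw [Nat.add_sub_cancel_left]
    ring

end MTensorW

/-! ### Tensor products with `W(r)` -/

section WithW

variable {K : Type*} [Field K] {r : ℕ} {U' V' : Type*} [AddCommGroup U']
  [Module K U'] [AddCommGroup V'] [Module K V'] {X' Y' : U' →ₗ[K] V'}

theorem socleMap_W (F : Fin (r + 1) → U') (j : Fin r) :
    socleMap (same K (r + 1) r) (down K (r + 1) r) X' Y' F j
      = Y' (seq F j) - X' (seq F (j + 1)) := by
  rw [socleMap_apply, extend_same, extend_down]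
  simp only [Pi.sub_apply, seq_map]

theorem socleMap_W_surjective (h : Function.Surjective X' ∨ Function.Surjective Y') :
    Function.Surjective (socleMap (same K (r + 1) r) (down K (r + 1) r) X' Y') := by
  intro L
  rcases h with h | h
  · -- solve for the entries one after the other, starting with the first one
    obtain ⟨G, hG⟩ : ∃ G : ℕ → U', ∀ k, X' (G (k + 1)) = Y' (G k) - seq L k := by
      choose S hS using h
      exact ⟨fun k => Nat.rec 0 (fun k w => S (Y' w - seq L k)) k, fun k => hS _⟩
    refine ⟨fun i => G i, ?_⟩
    funext j
    rw [socleMap_W, seq_mk, seq_mk, if_pos (by omega), if_pos (by omega), hG, seq_val]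
    simp
  · obtain ⟨G, hG⟩ : ∃ G : ℕ → U', ∀ k, Y' (G (k + 1)) = X' (G k) + seq L (r - 1 - k) := by
      choose S hS using h
      exact ⟨fun k => Nat.rec 0 (fun k w => S (X' w + seq L (r - 1 - k))) k, fun k => hS _⟩
    refine ⟨fun i => G (r - i), ?_⟩
    funext j
    rw [socleMap_W, seq_mk (fun k => G (r - k)), seq_mk (fun k => G (r - k)), if_pos (by omega),
      if_pos (by omega), show r - j = r - (j + 1) + 1 by omega, hG,
      show r - 1 - (r - (j + 1)) = j by omega, seq_val]
    simp

variable [CharZero K] [FiniteDimensional K U'] [FiniteDimensional K V']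
  {R₁ R₂ : Type*} [AddCommGroup R₁] [Module K R₁] [AddCommGroup R₂] [Module K R₂]
  [FiniteDimensional K R₁] [FiniteDimensional K R₂] {XR YR : R₁ →ₗ[K] R₂}

/-- The kernel criterion for the first factor `W(r)`, in terms of the components of the maps. -/
theorem W_tensor (ι₀ : ℕ → R₁ →ₗ[K] U') (δ : ℕ → R₂ →ₗ[K] U') (γ : ℕ → R₂ →ₗ[K] V')
    (hX₁ : ∀ i < r, ι₀ i = δ i ∘ₗ XR) (hY₁ : ∀ i < r, ι₀ (i + 1) = δ i ∘ₗ YR)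
    (hX₂ : ∀ i ≤ r, X' ∘ₗ ι₀ i = γ i ∘ₗ XR) (hY₂ : ∀ i ≤ r, Y' ∘ₗ ι₀ i = γ i ∘ₗ YR)
    (hX₃ : ∀ i < r, γ i = X' ∘ₗ δ i) (hY₃ : ∀ i < r, γ (i + 1) = Y' ∘ₗ δ i)
    (hι : ∀ w, (∀ i ≤ r, ι₀ i w = 0) → w = 0) (hγ : ∀ w, (∀ i ≤ r, γ i w = 0) → w = 0)
    (hsurj : Function.Surjective X' ∨ Function.Surjective Y') {n : ℕ}
    (hn : r * finrank K V' = n)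
    (hT : ((r + 1) + r) * (finrank K U' + finrank K V') = 4 * n + (finrank K R₁ + finrank K R₂)) :
    Nonempty (HTensor K (RepW K r) (TwoStep X' Y') ≃ₗ[Taft K]
      (Fin n → RepP K 1 1) × TwoStep XR YR) := by
  refine split_of_kernel (LinearMap.pi fun i : Fin (r + 1) => ι₀ i)
    (LinearMap.pi fun i : Fin r => δ i) (LinearMap.pi fun i : Fin (r + 1) => γ i) ?_ ?_ ?_ ?_ ?_ ?_
    ?_ ?_ (socleMap_W_surjective hsurj) hn hT
  · intro w
    funext i
    rw [extend_same]
    exact (seq_mk (fun k => ι₀ k w) i).trans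
      ((if_pos (by omega)).trans (LinearMap.congr_fun (hX₁ i i.2) w))
  · intro w
    funext i
    rw [extend_down]
    exact (seq_mk (fun k => ι₀ k w) (i + 1)).trans
      ((if_pos (by omega)).trans (LinearMap.congr_fun (hY₁ i i.2) w))
  · exact fun w i => LinearMap.congr_fun (hX₂ i (by omega)) w
  · exact fun w i => LinearMap.congr_fun (hY₂ i (by omega)) w
  · intro w i
    rw [extend_same]
    exact (seq_mk (fun k => γ k w) i).trans
      ((if_pos (by omega)).trans (LinearMap.congr_fun (hX₃ i i.2) w))
  · intro w i
    rw [extend_down]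
    exact (seq_mk (fun k => γ k w) (i + 1)).trans
      ((if_pos (by omega)).trans (LinearMap.congr_fun (hY₃ i i.2) w))
  · exact fun w hw => hι w fun i hi => congrFun hw ⟨i, by omega⟩
  · exact fun w _ hw => hγ w fun i hi => congrFun hw ⟨i, by omega⟩

/-- The tensor product of `W(r)` with a band module or a string module of even dimension: the
second factor embeds by the maps `X^(r-i) Y^i` to the `i`-th entry. -/
theorem W_tensor_commuting {s : ℕ} {X Y : (Fin s → K) →ₗ[K] (Fin s → K)} (hXY : Commute X Y)
    (h : Function.Bijective X ∨ Function.Bijective Y) :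
    Nonempty (HTensor K (RepW K r) (TwoStep X Y) ≃ₗ[Taft K]
      (Fin (r * s) → RepP K 1 1) × TwoStep X Y) := by
  have hinj : ∀ w, (∀ i ≤ r, (X ^ (r - i) * Y ^ i) w = 0) → w = 0 := fun w hw => by
    rcases h with h | h
    · have := hw 0 (by omega)
      rw [Nat.sub_zero, pow_zero, mul_one, Module.End.coe_pow] at this
      exact h.1.iterate r (this.trans (by rw [← Module.End.coe_pow, map_zero]))
    · have := hw r le_rfl
      rw [Nat.sub_self, pow_zero, one_mul, Module.End.coe_pow] at this
      exact h.1.iterate r (this.trans (by rw [← Module.End.coe_pow, map_zero]))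
  have hYX : ∀ i j, Y * (X ^ i * Y ^ j) = X ^ i * Y ^ (j + 1) := fun i j => by
    rw [← mul_assoc, (hXY.symm.pow_right i).eq, mul_assoc, pow_succ']
  have hX : ∀ i j, X ^ i * Y ^ j * X = X ^ (i + 1) * Y ^ j := fun i j => by
    rw [mul_assoc, ← (hXY.pow_right j).eq, ← mul_assoc, pow_succ]
  refine W_tensor (fun i => X ^ (r - i) * Y ^ i) (fun i => X ^ (r - 1 - i) * Y ^ i)
    (fun i => X ^ (r - i) * Y ^ i) ?_ ?_ ?_ ?_ ?_ ?_ hinj hinj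
    (h.imp (fun h => h.2) fun h => h.2) (by simp) (by simp; ring)
  · intro i hi
    rw [← Module.End.mul_eq_comp, hX, show r - i = r - 1 - i + 1 by omega]
  · intro i hi
    rw [← Module.End.mul_eq_comp, mul_assoc, ← pow_succ, show r - (i + 1) = r - 1 - i by omega]
  · intro i hi
    rw [← Module.End.mul_eq_comp, ← Module.End.mul_eq_comp, hX, ← mul_assoc, pow_succ']
  · intro i hi
    rw [← Module.End.mul_eq_comp, ← Module.End.mul_eq_comp, hYX, mul_assoc, pow_succ]
  · intro i hi
    rw [← Module.End.mul_eq_comp, ← mul_assoc, ← pow_succ', show r - i = r - 1 - i + 1 by omega]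
  · intro i hi
    rw [← Module.End.mul_eq_comp, hYX, show r - (i + 1) = r - 1 - i by omega]

omit [CharZero K] in
theorem eq_zero_of_shiftDown {m n : ℕ} (hn : 0 < n) (hm : m ≤ r + n) (f : Fin m → K)
    (hf : ∀ i ≤ r, shiftDown K m n i f = 0) : f = 0 := by
  refine eq_zero_of_seq fun k => ?_
  obtain ⟨i, j, hi, hj, hk⟩ : ∃ i j : ℕ, (i ≤ r) ∧ j < n ∧ (j + i = k ∨ m ≤ k) := by
    rcases Nat.lt_or_ge k n with h | h
    · exact ⟨0, k, by omega, h, by omega⟩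
    · rcases Nat.lt_or_ge k m with h' | h'
      · exact ⟨k - (n - 1), n - 1, by omega, by omega, by omega⟩
      · exact ⟨0, 0, by omega, hn, .inr h'⟩
  rcases hk with rfl | hk
  · exact congrFun (hf i hi) ⟨j, hj⟩
  · exact seq_of_le hk

/-- The submodule `W(r + s)` consists of the arrays which are constant on antidiagonals. -/
theorem W_tensor_W {s : ℕ} (hs : 0 < s) :
    Nonempty (HTensor K (RepW K r) (RepW K s) ≃ₗ[Taft K]
      (Fin (r * s) → RepP K 1 1) × RepW K (r + s)) := by
  refine W_tensor (shiftDown K (r + s + 1) (s + 1)) (shiftDown K (r + s) (s + 1))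
    (shiftDown K (r + s) s) ?_ ?_ ?_ ?_ ?_ ?_ (eq_zero_of_shiftDown (by omega) (by omega))
    (eq_zero_of_shiftDown hs (by omega)) (.inl (same_surjective (by omega))) (by simp)
    (by simp; ring)
  all_goals
    intro i hi
    refine LinearMap.ext fun f => ?_
    funext k
    simp only [LinearMap.comp_apply, shiftDown_apply, same_apply, down_apply]
    simp only [seq]
    grind

end WithW

/-! ### Tensor products of two string modules of even dimension or band modules -/

section Pencil

variable {K : Type*} [Field K] {r s : ℕ}

variable (K) in
theorem same_self (r : ℕ) : same K r r = 1 := by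
  refine LinearMap.ext fun f => ?_
  rw [same_apply]
  funext j
  exact seq_val f j

variable (K) in
/-- On `C(r, η)`, the map given by `y` is `η + J`, where `J` is the nilpotent Jordan block. -/
theorem band_eq (r : ℕ) (η : K) :
    (onBasis K r r fun i => η • bv K r i + bv K r (i - 1)) = η • same K r r + down K r r := by
  refine (Pi.basisFun K (Fin r)).ext fun i => ?_
  simp only [Pi.basisFun_apply, LinearMap.add_apply, LinearMap.smul_apply, onBasis_single]

theorem extend_add_smul (a b : K) {E : Type*} [AddCommGroup E] [Module K E] (F : Fin r → E) :
    extend (a • same K r r + b • down K r r) E F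
      = fun j : Fin r => a • seq F j + b • seq F (j + 1) := by
  have : extend (a • same K r r + b • down K r r) E F
      = a • extend (same K r r) E F + b • extend (down K r r) E F := by
    funext j
    simp [extend, add_smul, Finset.sum_add_distrib, Finset.smul_sum, smul_smul]
  rw [this, extend_same, extend_down]
  rfl

theorem add_smul_apply (a b : K) (f : Fin r → K) :
    (a • same K r r + b • down K r r) f = fun j : Fin r => a * seq f j + b * seq f (j + 1) := by
  rw [← extend_self, extend_add_smul]
  rfl

theorem add_smul_injective {a : K} (ha : a ≠ 0) (b : K) :
    Function.Injective (a • same K r r + b • down K r r) := by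
  rw [injective_iff_map_eq_zero]
  intro f hf
  rw [add_smul_apply] at hf
  refine eq_zero_of_seq_succ fun k hk hk' => ?_
  have := congrFun hf ⟨k, hk⟩
  simpa [hk', ha] using this

/-- If `X = 1` and `Y = a + J` for the nilpotent Jordan block `J`, and `a` is not an eigenvalue of
the second pencil, then the map `X ⊗ Y' - Y ⊗ X'` is block triangular with the invertible diagonal
blocks `Y' - a X'`. -/
theorem band_tensor_bijective [CharZero K] {a : K} {X' Y' : (Fin s → K) →ₗ[K] (Fin s → K)}
    {Y : (Fin r → K) →ₗ[K] (Fin r → K)} (hY : Y = a • same K r r + (1 : K) • down K r r)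
    (h : Function.Injective (Y' - a • X')) :
    Nonempty (HTensor K (TwoStep (same K r r) Y) (TwoStep X' Y') ≃ₗ[Taft K]
      (Fin (r * s) → RepP K 1 1)) := by
  subst hY
  refine split_of_bijective (fun F hF => ?_) (by simp) (by simp; ring)
  have key : ∀ k < r, (Y' - a • X') (seq F k) = X' (seq F (k + 1)) := fun k hk => by
    have := congrFun hF ⟨k, hk⟩
    rw [socleMap_apply, extend_same, extend_add_smul] at this
    simp only [Pi.sub_apply, seq_map, map_add, map_smul, one_smul, Pi.zero_apply] at this
    rw [LinearMap.sub_apply, LinearMap.smul_apply]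
    rw [← sub_sub] at this
    exact sub_eq_zero.1 this
  refine eq_zero_of_seq_succ fun k hk hk' => h ?_
  rw [key k hk, hk', map_zero, map_zero]

end Pencil

section Equal

variable {K : Type*} [Field K] [CharZero K] {r s : ℕ}

/-- The matrix constant on antidiagonals whose first row is the given sequence. -/
def antidiagonals (K : Type*) [Field K] (s r : ℕ) : (Fin s → K) →ₗ[K] (Fin r → Fin s → K) where
  toFun f i j := seq f (i + j)
  map_add' f g := by funext i j; simp only [seq_add, Pi.add_apply]
  map_smul' c f := by funext i j; simp only [seq_smul, Pi.smul_apply, RingHom.id_apply]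

omit [CharZero K] in
theorem antidiagonals_apply (f : Fin s → K) :
    antidiagonals K s r f = fun (i : Fin r) (j : Fin s) => seq f (i + j) := rfl

omit [CharZero K] in
theorem extend_antidiagonals (h : s ≤ r) (a b : K) (f : Fin s → K) :
    extend (a • same K r r + b • down K r r) _ (antidiagonals K s r f)
      = antidiagonals K s r ((a • same K s s + b • down K s s) f) := by
  funext i j
  rw [extend_add_smul, antidiagonals_apply, antidiagonals_apply, add_smul_apply]
  simp only [seq, dite_apply, Pi.add_apply, Pi.smul_apply, Pi.zero_apply, smul_eq_mul]
  grind

omit [CharZero K] in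
theorem map_antidiagonals (a b : K) (f : Fin s → K) (i : Fin r) :
    (a • same K s s + b • down K s s) (antidiagonals K s r f i)
      = antidiagonals K s r ((a • same K s s + b • down K s s) f) i := by
  funext j
  rw [antidiagonals_apply, antidiagonals_apply, add_smul_apply, add_smul_apply]
  simp only [seq]
  grind

omit [CharZero K] in
theorem antidiagonals_injective (hr : 0 < r) (f : Fin s → K)
    (hf : antidiagonals K s r f ⟨0, hr⟩ = 0) : f = 0 := by
  funext j
  have := congrFun hf j
  rw [antidiagonals_apply] at this
  simpa [seq_val] using this

omit [CharZero K] in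
/-- The map `X ⊗ Y' - Y ⊗ X'` is the determinant of the pencil times `1 ⊗ J - J ⊗ 1`, where `J`
is the nilpotent Jordan block. -/
theorem socleMap_pencil (a b c d : K) (F : Fin r → Fin s → K) (j : Fin r) :
    socleMap (a • same K r r + b • down K r r) (c • same K r r + d • down K r r)
      (a • same K s s + b • down K s s) (c • same K s s + d • down K s s) F j
      = (a * d - b * c) • (down K s s (seq F j) - seq F (j + 1)) := by
  rw [socleMap_apply, extend_add_smul, extend_add_smul]
  simp only [Pi.sub_apply, seq_map]
  simp only [same_self, LinearMap.add_apply, LinearMap.smul_apply, Module.End.one_apply,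
    map_add, map_smul]
  module

/-- The tensor product of two modules given by the same pencil in the identity and a nilpotent
Jordan block: the complement of the projective summand is the sum of the smaller one of the two
modules, embedded as arrays constant on antidiagonals, and its twist, embedded as the product with
the last vector in the socle of the first factor. -/
theorem pencil_tensor_of_le (hs : 0 < s) (h : s ≤ r) {a b c d : K} (hdet : a * d - b * c ≠ 0)
    {X Y : (Fin r → K) →ₗ[K] (Fin r → K)} {X' Y' : (Fin s → K) →ₗ[K] (Fin s → K)}
    (hX : X = a • same K r r + b • down K r r) (hY : Y = c • same K r r + d • down K r r)
    (hX' : X' = a • same K s s + b • down K s s) (hY' : Y' = c • same K s s + d • down K s s) :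
    Nonempty (HTensor K (TwoStep X Y) (TwoStep X' Y') ≃ₗ[Taft K]
      (Fin (r * s - s) → RepP K 1 1) × TwoStep X' Y' ×
        HTensor K (TwoStep X' Y') (RepS K (-1) (-1))) := by
  have hXι : ∀ w, extend X _ (antidiagonals K s r w) = antidiagonals K s r (X' w) := by
    rw [hX, hX']; exact extend_antidiagonals h a b
  have hYι : ∀ w, extend Y _ (antidiagonals K s r w) = antidiagonals K s r (Y' w) := by
    rw [hY, hY']; exact extend_antidiagonals h c d
  have hXι' : ∀ w i, X' (antidiagonals K s r w i) = antidiagonals K s r (X' w) i := by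
    rw [hX']; exact map_antidiagonals a b
  have hYι' : ∀ w i, Y' (antidiagonals K s r w i) = antidiagonals K s r (Y' w) i := by
    rw [hY']; exact map_antidiagonals c d
  have hD : ∀ F j, socleMap X Y X' Y' F j
      = (a * d - b * c) • (down K s s (seq F j) - seq F (j + 1)) := by
    rw [hX, hY, hX', hY']; exact socleMap_pencil a b c d
  clear hX hY hX' hY'
  let ι₀ := antidiagonals K s r
  let last : (Fin s → K) →ₗ[K] (Fin r → Fin s → K) :=
    LinearMap.single K (fun _ => Fin s → K) ⟨r - 1, by omega⟩
  have hlast : ∀ (Z : (Fin s → K) →ₗ[K] (Fin s → K)) w i, Z (last w i) = last (Z w) i := by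
    intro Z w i
    simp only [last, LinearMap.coe_single, Pi.single_apply]
    split_ifs <;> simp
  have hlast0 : ∀ w, last w = 0 → w = 0 := fun w hw => by
    have := congrFun hw ⟨r - 1, by omega⟩
    rwa [LinearMap.coe_single, Pi.single_eq_same] at this
  -- the first summand in `U ⊗ U'` and, diagonally, in `V ⊗ U' ⊕ U ⊗ V'`; the second one in `V ⊗ U'`
  -- and `V ⊗ V'`, with the sign from `g` and `h` acting on `V`
  obtain ⟨σ, hσ⟩ : ∃ σ : TwoStep X' Y' × HTensor K (TwoStep X' Y') (RepS K (-1) (-1)) →ₗ[K]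
      HTensor K (TwoStep X Y) (TwoStep X' Y'), ∀ w, coord X Y X' Y' (σ w) =
        (ι₀ (equiv X' Y' w.1).1, ι₀ (equiv X' Y' w.1).2 + last (twistEquiv X' Y' w.2).1,
          ι₀ (equiv X' Y' w.1).2, -last (twistEquiv X' Y' w.2).2) :=
    ⟨(coord X Y X' Y').symm.toLinearMap ∘ₗ
      (LinearMap.prod (ι₀ ∘ₗ LinearMap.fst K _ _ ∘ₗ LinearMap.fst K _ _)
      (LinearMap.prod (ι₀ ∘ₗ LinearMap.snd K _ _ ∘ₗ LinearMap.fst K _ _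
        + last ∘ₗ LinearMap.fst K _ _ ∘ₗ LinearMap.snd K _ _)
      (LinearMap.prod (ι₀ ∘ₗ LinearMap.snd K _ _ ∘ₗ LinearMap.fst K _ _)
      (-(last ∘ₗ LinearMap.snd K _ _ ∘ₗ LinearMap.snd K _ _))))) ∘ₗ
      ((equiv X' Y').prodCongr (twistEquiv X' Y')).toLinearMap, fun w => by simp⟩
  -- the projective summand is generated by the arrays with vanishing first row
  refine split_of_injective (topIncl X Y X' Y' ∘ₗ extend (up K (r - 1) r) (Fin s → K))
    (fun w => by rw [LinearMap.comp_apply, g_smul_topIncl])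
    (fun w => by rw [LinearMap.comp_apply, h_smul_topIncl]) σ ?_ ?_ ?_ ?_ ?_
  · intro i w
    apply (coord X Y X' Y').injective
    rw [hσ]
    cases i
    · rw [coord_g_smul, hσ, Prod.smul_fst, Prod.smul_snd, equiv_g_smul, twistEquiv_g_smul]
      refine Prod.ext ?_ (Prod.ext ?_ (Prod.ext ?_ ?_)) <;> simp [add_comm]
    · rw [coord_h_smul, hσ, Prod.smul_fst, Prod.smul_snd, equiv_h_smul, twistEquiv_h_smul]
      refine Prod.ext ?_ (Prod.ext ?_ (Prod.ext ?_ ?_)) <;> simp [add_comm]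
    · rw [coord_x_smul, hσ, Prod.smul_fst, Prod.smul_snd, equiv_x_smul, twistEquiv_x_smul]
      refine Prod.ext ?_ (Prod.ext ?_ (Prod.ext ?_ ?_)) <;> funext i <;>
        simp [coordAct, ι₀, hXι, hXι', hlast]
    · rw [coord_y_smul, hσ, Prod.smul_fst, Prod.smul_snd, equiv_y_smul, twistEquiv_y_smul]
      refine Prod.ext ?_ (Prod.ext ?_ (Prod.ext ?_ ?_)) <;> funext i <;>
        simp [coordAct, ι₀, hYι, hYι', hlast]
  · rw [injective_iff_map_eq_zero]
    intro w hw
    have h0 := hσ w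
    rw [hw, map_zero] at h0
    simp only [Prod.ext_iff, Prod.fst_zero, Prod.snd_zero] at h0
    obtain ⟨h1, h2, h3, h4⟩ := h0
    have e1 := antidiagonals_injective (by omega) _ (congrFun h1.symm ⟨0, by omega⟩)
    have e2 := antidiagonals_injective (by omega) _ (congrFun h3.symm ⟨0, by omega⟩)
    rw [← h3, zero_add] at h2
    have e3 := hlast0 _ h2.symm
    have e4 := hlast0 _ (neg_eq_zero.1 h4.symm)
    exact Prod.ext ((equiv X' Y').map_eq_zero_iff.1 (Prod.ext e1 e2))
      ((twistEquiv X' Y').map_eq_zero_iff.1 (Prod.ext e3 e4))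
  · intro w t ht
    have h2 := congrArg (coord X Y X' Y') ht
    rw [LinearMap.comp_apply, coord_xy_topIncl, hσ] at h2
    simp only [Prod.ext_iff] at h2
    -- away from the last row, the image of `w` under `X ⊗ Y' - Y ⊗ X'` vanishes
    have key : ∀ k < r - 1, seq w k = down K s s (if k = 0 then 0 else seq w (k - 1)) := by
      intro k hk
      have h3 := congrFun h2.2.2.2 ⟨k, by omega⟩
      rw [hD, extend_up, seq_mk (fun j => if j = 0 then 0 else seq w (j - 1)),
        seq_mk (fun j => if j = 0 then 0 else seq w (j - 1)), if_pos (by omega : k < r),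
        if_pos (by omega : k + 1 < r)] at h3
      simp only [Pi.neg_apply, last, LinearMap.coe_single] at h3
      rw [Pi.single_eq_of_ne (by simp [Fin.ext_iff]; omega), neg_zero, smul_eq_zero_iff_right hdet,
        sub_eq_zero] at h3
      simpa using h3.symm
    refine eq_zero_of_seq fun k => ?_
    induction k with
    | zero =>
      rcases Nat.lt_or_ge 0 (r - 1) with hk | hk
      · rw [key 0 hk]; simp
      · exact seq_of_le hk
    | succ k ih =>
      rcases Nat.lt_or_ge (k + 1) (r - 1) with hk | hk
      · rw [key _ hk]; simp [ih]
      · exact seq_of_le hk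
  · rw [finrank_pi_fintype, Finset.sum_const, Finset.card_univ, Fintype.card_fin, finrank_fin_pi,
      finrank_self, mul_one, smul_eq_mul, Nat.sub_mul, one_mul]
  · rw [finrank_tensor, finrank_prod, finrank_eq, finrank_twist]
    obtain ⟨r, rfl⟩ : ∃ q, r = q + 1 := ⟨r - 1, by omega⟩
    simp only [finrank_fin_pi, finrank_self, mul_one, Nat.add_mul, one_mul, Nat.add_sub_cancel]
    ring

end Equal

/-! ### Commutativity of the tensor product of two-step modules -/

section Swap

variable {K : Type*} [Field K] {U V U' V' : Type*} [AddCommGroup U] [Module K U] [AddCommGroup V]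
  [Module K V] [AddCommGroup U'] [Module K U'] [AddCommGroup V'] [Module K V']
  (X Y : U →ₗ[K] V) (X' Y' : U' →ₗ[K] V')

/-- The projection of a two-step module to its top `U`. -/
def evenPart : TwoStep X Y →ₗ[K] TwoStep X Y :=
  (equiv X Y).symm.toLinearMap ∘ₗ LinearMap.prodMap LinearMap.id 0 ∘ₗ (equiv X Y).toLinearMap

/-- The projection of a two-step module to its socle `V`. -/
def oddPart : TwoStep X Y →ₗ[K] TwoStep X Y :=
  (equiv X Y).symm.toLinearMap ∘ₗ LinearMap.prodMap 0 LinearMap.id ∘ₗ (equiv X Y).toLinearMap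

variable {X Y X' Y'}

theorem equiv_evenPart (m : TwoStep X Y) :
    equiv X Y (evenPart X Y m) = ((equiv X Y m).1, 0) := by
  simp [evenPart]

theorem equiv_oddPart (m : TwoStep X Y) :
    equiv X Y (oddPart X Y m) = (0, (equiv X Y m).2) := by
  simp [oddPart]

theorem h_smul_eq_g_smul (m : TwoStep X Y) : Taft.gen K .h • m = Taft.gen K .g • m := by
  apply (equiv X Y).injective
  rw [equiv_h_smul, equiv_g_smul]

theorem evenPart_add_oddPart (m : TwoStep X Y) : evenPart X Y m + oddPart X Y m = m := by
  apply (equiv X Y).injective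
  rw [map_add, equiv_evenPart, equiv_oddPart]; simp

theorem g_smul_evenPart (m : TwoStep X Y) : Taft.gen K .g • evenPart X Y m = evenPart X Y m := by
  apply (equiv X Y).injective
  rw [equiv_g_smul, equiv_evenPart]; simp

theorem g_smul_oddPart (m : TwoStep X Y) : Taft.gen K .g • oddPart X Y m = -oddPart X Y m := by
  apply (equiv X Y).injective
  rw [equiv_g_smul, map_neg, equiv_oddPart]; simp

theorem evenPart_g_smul (m : TwoStep X Y) :
    evenPart X Y (Taft.gen K .g • m) = evenPart X Y m := by
  apply (equiv X Y).injective
  rw [equiv_evenPart, equiv_evenPart, equiv_g_smul]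

theorem oddPart_g_smul (m : TwoStep X Y) :
    oddPart X Y (Taft.gen K .g • m) = -oddPart X Y m := by
  apply (equiv X Y).injective
  rw [map_neg, equiv_oddPart, equiv_oddPart, equiv_g_smul]; simp

theorem evenPart_x_smul (m : TwoStep X Y) : evenPart X Y (Taft.gen K .x • m) = 0 := by
  apply (equiv X Y).injective
  rw [equiv_evenPart, equiv_x_smul, map_zero]; rfl

theorem evenPart_y_smul (m : TwoStep X Y) : evenPart X Y (Taft.gen K .y • m) = 0 := by
  apply (equiv X Y).injective
  rw [equiv_evenPart, equiv_y_smul, map_zero]; rfl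

theorem oddPart_x_smul (m : TwoStep X Y) :
    oddPart X Y (Taft.gen K .x • m) = Taft.gen K .x • m := by
  apply (equiv X Y).injective
  rw [equiv_oddPart, equiv_x_smul]

theorem oddPart_y_smul (m : TwoStep X Y) :
    oddPart X Y (Taft.gen K .y • m) = Taft.gen K .y • m := by
  apply (equiv X Y).injective
  rw [equiv_oddPart, equiv_y_smul]

theorem x_smul_evenPart (m : TwoStep X Y) :
    Taft.gen K .x • evenPart X Y m = Taft.gen K .x • m := by
  apply (equiv X Y).injective
  rw [equiv_x_smul, equiv_x_smul, equiv_evenPart]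

theorem y_smul_evenPart (m : TwoStep X Y) :
    Taft.gen K .y • evenPart X Y m = Taft.gen K .y • m := by
  apply (equiv X Y).injective
  rw [equiv_y_smul, equiv_y_smul, equiv_evenPart]

theorem x_smul_oddPart (m : TwoStep X Y) : Taft.gen K .x • oddPart X Y m = 0 := by
  apply (equiv X Y).injective
  rw [equiv_x_smul, equiv_oddPart, map_zero, map_zero]; rfl

theorem y_smul_oddPart (m : TwoStep X Y) : Taft.gen K .y • oddPart X Y m = 0 := by
  apply (equiv X Y).injective
  rw [equiv_y_smul, equiv_oddPart, map_zero, map_zero]; rfl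

/-- The exchange of the factors with the sign rule for odd vectors, as a linear map; the sign is
written as the action of `g`. -/
theorem exists_swap (X Y : U →ₗ[K] V) (X' Y' : U' →ₗ[K] V') :
    ∃ f : HTensor K (TwoStep X Y) (TwoStep X' Y') →ₗ[K] HTensor K (TwoStep X' Y') (TwoStep X Y),
      ∀ m n, f (HTensor.tmul K m n) = HTensor.tmul K n (evenPart X Y m)
        + HTensor.tmul K (Taft.gen K .g • n) (oddPart X Y m) := by
  obtain ⟨L, hL⟩ : ∃ L : TwoStep X' Y' →ₗ[K] TwoStep X' Y', ∀ n, L n = Taft.gen K .g • n :=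
    ⟨Algebra.lsmul K K _ (Taft.gen K .g), fun n => rfl⟩
  refine ⟨(HTensor.toTensor K _ _).symm.toLinearMap ∘ₗ
    (TensorProduct.comm K _ _).toLinearMap ∘ₗ
    (TensorProduct.map (evenPart X Y) LinearMap.id + TensorProduct.map (oddPart X Y) L) ∘ₗ
    (HTensor.toTensor K _ _).toLinearMap, fun m n => ?_⟩
  simp only [LinearMap.comp_apply, LinearEquiv.coe_coe, HTensor.toTensor_tmul,
    LinearMap.add_apply, TensorProduct.map_tmul, LinearMap.id_apply, map_add,
    TensorProduct.comm_tmul, hL]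
  rfl

section

variable {M N : Type*} [AddCommGroup M] [Module K M] [AddCommGroup N] [Module K N]

theorem tmul_add (m : M) (n n' : N) :
    HTensor.tmul K m (n + n') = HTensor.tmul K m n + HTensor.tmul K m n' :=
  TensorProduct.tmul_add m n n'

theorem add_tmul (m m' : M) (n : N) :
    HTensor.tmul K (m + m') n = HTensor.tmul K m n + HTensor.tmul K m' n :=
  TensorProduct.add_tmul m m' n

theorem tmul_neg (m : M) (n : N) : HTensor.tmul K m (-n) = -HTensor.tmul K m n :=
  TensorProduct.tmul_neg m n

theorem neg_tmul (m : M) (n : N) : HTensor.tmul K (-m) n = -HTensor.tmul K m n :=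
  TensorProduct.neg_tmul m n

theorem tmul_zero (m : M) : HTensor.tmul K m (0 : N) = 0 := TensorProduct.tmul_zero N m

end

theorem swap_comp_swap
    (f : HTensor K (TwoStep X Y) (TwoStep X' Y') →ₗ[K] HTensor K (TwoStep X' Y') (TwoStep X Y))
    (f' : HTensor K (TwoStep X' Y') (TwoStep X Y) →ₗ[K] HTensor K (TwoStep X Y) (TwoStep X' Y'))
    (hf : ∀ m n, f (HTensor.tmul K m n) = HTensor.tmul K n (evenPart X Y m)
      + HTensor.tmul K (Taft.gen K .g • n) (oddPart X Y m))
    (hf' : ∀ m n, f' (HTensor.tmul K m n) = HTensor.tmul K n (evenPart X' Y' m)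
      + HTensor.tmul K (Taft.gen K .g • n) (oddPart X' Y' m)) :
    f' ∘ₗ f = LinearMap.id := by
  refine HTensor.ext fun m n => ?_
  rw [LinearMap.comp_apply, hf, map_add, hf', hf', evenPart_g_smul, oddPart_g_smul,
    g_smul_evenPart, g_smul_oddPart, neg_tmul, tmul_neg, neg_neg, ← tmul_add, ← tmul_add,
    ← add_tmul, evenPart_add_oddPart, evenPart_add_oddPart, LinearMap.id_apply]

/-- The tensor product of two-step modules is commutative: as `g` and `h` act by the parity, the
exchange of the factors with the sign rule for odd vectors is an isomorphism. -/
theorem nonempty_swap (X Y : U →ₗ[K] V) (X' Y' : U' →ₗ[K] V') :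
    Nonempty (HTensor K (TwoStep X Y) (TwoStep X' Y') ≃ₗ[Taft K]
      HTensor K (TwoStep X' Y') (TwoStep X Y)) := by
  obtain ⟨f, hf⟩ := exists_swap X Y X' Y'
  obtain ⟨f', hf'⟩ := exists_swap X' Y' X Y
  refine Taft.nonempty_equiv_of_gen (LinearEquiv.ofLinearMap f f' (swap_comp_swap f' f hf' hf)
    (swap_comp_swap f f' hf hf')) fun i t => ?_
  obtain ⟨L, hL⟩ : ∃ L : HTensor K (TwoStep X Y) (TwoStep X' Y') →ₗ[K]
      HTensor K (TwoStep X Y) (TwoStep X' Y'), ∀ n, L n = Taft.gen K i • n :=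
    ⟨Algebra.lsmul K K _ (Taft.gen K i), fun n => rfl⟩
  obtain ⟨L', hL'⟩ : ∃ L : HTensor K (TwoStep X' Y') (TwoStep X Y) →ₗ[K]
      HTensor K (TwoStep X' Y') (TwoStep X Y), ∀ n, L n = Taft.gen K i • n :=
    ⟨Algebra.lsmul K K _ (Taft.gen K i), fun n => rfl⟩
  have : f ∘ₗ L = L' ∘ₗ f := HTensor.ext fun m n => by
    rw [LinearMap.comp_apply, LinearMap.comp_apply, hL, hL', hf, smul_add]
    cases i
    · rw [HTensor.g_smul, hf, HTensor.g_smul, HTensor.g_smul, evenPart_g_smul, oddPart_g_smul,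
        g_smul_evenPart, g_smul_oddPart]
    · rw [HTensor.h_smul, hf, HTensor.h_smul, HTensor.h_smul]
      simp only [h_smul_eq_g_smul, evenPart_g_smul, oddPart_g_smul, g_smul_evenPart,
        g_smul_oddPart]
    · rw [HTensor.x_smul, map_add, hf, hf, HTensor.x_smul, HTensor.x_smul, evenPart_g_smul,
        oddPart_g_smul, evenPart_x_smul, oddPart_x_smul, x_smul_evenPart, x_smul_oddPart,
        tmul_zero, tmul_zero, gx_smul, neg_tmul, tmul_neg, neg_neg]
      abel
    · rw [HTensor.y_smul, map_add, hf, hf, HTensor.y_smul, HTensor.y_smul, h_smul_eq_g_smul,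
        h_smul_eq_g_smul, h_smul_eq_g_smul, evenPart_g_smul,
        oddPart_g_smul, evenPart_y_smul, oddPart_y_smul, y_smul_evenPart, y_smul_oddPart,
        tmul_zero, tmul_zero, gy_smul, neg_tmul, tmul_neg, neg_neg]
      abel
  have h := LinearMap.congr_fun this t
  rw [LinearMap.comp_apply, LinearMap.comp_apply, hL, hL'] at h
  exact h

end Swap

end TwoStep

/-! ### Tensor products with `P` -/

namespace TwoStep

section WithP

variable {K : Type*} [Field K] [CharZero K]

/-- The tensor product of a two-step module with `P`, a special case of `tensor_P`. -/
theorem tensor_P_of_pi {a b : ℕ} (X Y : (Fin a → K) →ₗ[K] (Fin b → K)) :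
    Nonempty (HTensor K (TwoStep X Y) (RepP K 1 1) ≃ₗ[Taft K]
      (Fin a → RepP K 1 1) × (Fin b → RepP K (-1) (-1))) := by
  obtain ⟨e⟩ := tensor_P (Sum.elim (fun _ : Fin a => (1 : ℤˣ)) (fun _ : Fin b => (-1 : ℤˣ)))
    (((Pi.basisFun K (Fin a)).prod (Pi.basisFun K (Fin b))).map (equiv X Y).symm) (by
      intro i
      constructor <;> apply (equiv X Y).injective
      · rw [equiv_g_smul, map_smul]
        cases i <;> simp
      · rw [equiv_h_smul, map_smul]
        cases i <;> simp)
  exact ⟨e.trans (LinearEquiv.sumPiEquivProdPi (Taft K) _ _ _)⟩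

/-- The vectors `1` and `xy` of `P` have sign `1`, the vectors `x` and `y` have sign `-1`. -/
theorem P_tensor_P : Nonempty (HTensor K (RepP K 1 1) (RepP K 1 1) ≃ₗ[Taft K]
    (Fin 2 → RepP K 1 1) × (Fin 2 → RepP K (-1) (-1))) := by
  let f : ((K × K) × K × K) ≃ₗ[K] K × K × K × K :=
    { toFun := fun p => (p.1.1, p.2.1, p.2.2, p.1.2)
      invFun := fun q => ((q.1, q.2.2.2), q.2.1, q.2.2.1)
      map_add' := fun _ _ => rfl
      map_smul' := fun _ _ => rfl
      left_inv := fun _ => rfl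
      right_inv := fun _ => rfl }
  obtain ⟨e⟩ := tensor_P (Sum.elim (fun _ : Fin 2 => (1 : ℤˣ)) (fun _ : Fin 2 => (-1 : ℤˣ)))
    (((Basis.finTwoProd K).prod (Basis.finTwoProd K)).map (f.trans (RepP.equiv K 1 1).symm)) (by
      intro i
      rw [Basis.map_apply, LinearEquiv.trans_apply, RepP.equiv_symm_apply]
      generalize hq : f _ = q
      obtain ⟨a, b, c, d⟩ := q
      rw [RepP.g_smul_ofCoord, RepP.h_smul_ofCoord, ← map_smul]
      rcases i with i | i <;> fin_cases i <;> simp [f] at hq <;>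
        obtain ⟨rfl, rfl, rfl, rfl⟩ := hq <;> simp)
  exact ⟨e.trans (LinearEquiv.sumPiEquivProdPi (Taft K) _ _ _)⟩

end WithP

/-! ### The twist of `W(0)` -/

/-- The twist of `W(0)` is the simple module `S`. -/
theorem minus_W_zero (K : Type u) [Field K] :
    Nonempty (Minus K (RepW K 0) ≃ₗ[Taft K] RepS K (-1) (-1)) := by
  let f : ((Fin 1 → K) × (Fin 0 → K)) ≃ₗ[K] RepS K (-1) (-1) :=
    { toFun := fun p => p.1 0
      invFun := fun c => (fun _ => c, 0)
      map_add' := fun _ _ => rfl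
      map_smul' := fun _ _ => rfl
      left_inv := fun p => Prod.ext (funext fun i => by rw [Subsingleton.elim i 0])
        (Subsingleton.elim _ _)
      right_inv := fun _ => rfl }
  refine Taft.nonempty_equiv_of_gen ((twistEquiv _ _).trans f) fun i t => ?_
  simp only [LinearEquiv.trans_apply]
  cases i
  · rw [twistEquiv_g_smul, simple_g_smul]; rfl
  · rw [twistEquiv_h_smul, simple_h_smul]; rfl
  · rw [twistEquiv_x_smul, simple_x_smul]; rfl
  · rw [twistEquiv_y_smul, simple_y_smul]; rfl

/-! ### Tensor products of the modules with tops and socles of the same dimension -/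

section Square

variable {K : Type u} [Field K] {r s : ℕ}

theorem bijective_same (r : ℕ) : Function.Bijective (same K r r) :=
  ⟨same_injective le_rfl, same_surjective le_rfl⟩

theorem commute_same (Y : (Fin s → K) →ₗ[K] (Fin s → K)) : Commute (same K s s) Y := by
  rw [same_self]; exact Commute.one_left Y

variable [CharZero K]

/-- The tensor product of two members, of any sizes, of a family given by a nondegenerate pencil
in the identity and a nilpotent Jordan block. -/
theorem pencil_tensor {a b c d : K} (hdet : a * d - b * c ≠ 0)
    {X Y : ∀ n : ℕ, (Fin n → K) →ₗ[K] (Fin n → K)}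
    (hX : ∀ n, X n = a • same K n n + b • down K n n)
    (hY : ∀ n, Y n = c • same K n n + d • down K n n) (hr : 0 < r) (hs : 0 < s) :
    Nonempty (HTensor K (TwoStep (X r) (Y r)) (TwoStep (X s) (Y s)) ≃ₗ[Taft K]
      (Fin (r * s - min r s) → RepP K 1 1) × TwoStep (X (min r s)) (Y (min r s)) ×
        Minus K (TwoStep (X (min r s)) (Y (min r s)))) := by
  rcases Nat.le_total s r with h | h
  · rw [Nat.min_eq_right h]
    exact pencil_tensor_of_le hs h hdet (hX r) (hY r) (hX s) (hY s)
  · rw [Nat.min_eq_left h, Nat.mul_comm]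
    obtain ⟨e⟩ := nonempty_swap (X r) (Y r) (X s) (Y s)
    obtain ⟨e'⟩ := pencil_tensor_of_le hr h hdet (hX s) (hY s) (hX r) (hY r)
    exact ⟨e.trans e'⟩

end Square

end TwoStep

end TaftTwo

end

theorem theorem3p2 (K : Type*) [Field K] [IsAlgClosed K] [CharZero K]
    (r s : ℕ) (hr : 0 < r) (hs : 0 < s) (η γ : K) (hη : η ≠ 0) (hγ : γ ≠ 0) :
    -- (1)
    Nonempty (HTensor K (RepP K 1 1) (RepP K 1 1) ≃ₗ[Taft K]
      (Fin 2 → RepP K 1 1) × (Fin 2 → RepP K (-1) (-1))) ∧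
    -- (2)
    Nonempty (HTensor K (RepM K r) (RepP K 1 1) ≃ₗ[Taft K]
      (Fin r → RepP K 1 1) × (Fin (r + 1) → RepP K (-1) (-1))) ∧
    Nonempty (HTensor K (RepW K r) (RepP K 1 1) ≃ₗ[Taft K]
      (Fin (r + 1) → RepP K 1 1) × (Fin r → RepP K (-1) (-1))) ∧
    -- (3)
    Nonempty (HTensor K (RepC K r η) (RepP K 1 1) ≃ₗ[Taft K]
      (Fin r → RepP K 1 1) × (Fin r → RepP K (-1) (-1))) ∧
    Nonempty (HTensor K (RepN K r) (RepP K 1 1) ≃ₗ[Taft K]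
      (Fin r → RepP K 1 1) × (Fin r → RepP K (-1) (-1))) ∧
    Nonempty (HTensor K (RepN' K r) (RepP K 1 1) ≃ₗ[Taft K]
      (Fin r → RepP K 1 1) × (Fin r → RepP K (-1) (-1))) ∧
    -- (4)
    Nonempty (HTensor K (RepM K r) (RepM K s) ≃ₗ[Taft K]
      (Fin (r * s) → RepP K 1 1) × Minus K (RepM K (r + s))) ∧
    -- (5)
    Nonempty (HTensor K (RepW K r) (RepW K s) ≃ₗ[Taft K]
      (Fin (r * s) → RepP K 1 1) × RepW K (r + s)) ∧
    -- (6)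
    (r < s → Nonempty (HTensor K (RepM K r) (RepW K s) ≃ₗ[Taft K]
      (Fin (r * (s + 1)) → RepP K 1 1) × Minus K (RepW K (s - r)))) ∧
    (r = s → Nonempty (HTensor K (RepM K r) (RepW K s) ≃ₗ[Taft K]
      (Fin (r * (r + 1)) → RepP K 1 1) × RepS K (-1) (-1))) ∧
    (s < r → Nonempty (HTensor K (RepM K r) (RepW K s) ≃ₗ[Taft K]
      (Fin ((r + 1) * s) → RepP K 1 1) × RepM K (r - s))) ∧
    -- (7)
    Nonempty (HTensor K (RepM K r) (RepC K s η) ≃ₗ[Taft K]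
      (Fin (r * s) → RepP K 1 1) × Minus K (RepC K s η)) ∧
    -- (8)
    Nonempty (HTensor K (RepW K r) (RepC K s η) ≃ₗ[Taft K]
      (Fin (r * s) → RepP K 1 1) × RepC K s η) ∧
    -- (9)
    Nonempty (HTensor K (RepM K r) (RepN K s) ≃ₗ[Taft K]
      (Fin (r * s) → RepP K 1 1) × Minus K (RepN K s)) ∧
    Nonempty (HTensor K (RepM K r) (RepN' K s) ≃ₗ[Taft K]
      (Fin (r * s) → RepP K 1 1) × Minus K (RepN' K s)) ∧
    -- (10)
    Nonempty (HTensor K (RepW K r) (RepN K s) ≃ₗ[Taft K]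
      (Fin (r * s) → RepP K 1 1) × RepN K s) ∧
    Nonempty (HTensor K (RepW K r) (RepN' K s) ≃ₗ[Taft K]
      (Fin (r * s) → RepP K 1 1) × RepN' K s) ∧
    -- (11)
    (η ≠ γ → Nonempty (HTensor K (RepC K r η) (RepC K s γ) ≃ₗ[Taft K]
      (Fin (r * s) → RepP K 1 1))) ∧
    (η = γ → Nonempty (HTensor K (RepC K r η) (RepC K s γ) ≃ₗ[Taft K]
      (Fin (r * s - min r s) → RepP K 1 1) ×
        RepC K (min r s) η × Minus K (RepC K (min r s) η))) ∧
    -- (12)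
    Nonempty (HTensor K (RepN K r) (RepN K s) ≃ₗ[Taft K]
      (Fin (r * s - min r s) → RepP K 1 1) × RepN K (min r s) × Minus K (RepN K (min r s))) ∧
    -- (13)
    Nonempty (HTensor K (RepN' K r) (RepN' K s) ≃ₗ[Taft K]
      (Fin (r * s - min r s) → RepP K 1 1) ×
        RepN' K (min r s) × Minus K (RepN' K (min r s))) ∧
    -- (14)
    Nonempty (HTensor K (RepN K r) (RepN' K s) ≃ₗ[Taft K] (Fin (r * s) → RepP K 1 1)) ∧
    Nonempty (HTensor K (RepC K r η) (RepN K s) ≃ₗ[Taft K] (Fin (r * s) → RepP K 1 1)) ∧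
    Nonempty (HTensor K (RepC K r η) (RepN' K s) ≃ₗ[Taft K] (Fin (r * s) → RepP K 1 1)) := by
  have band : ∀ (η : K) (n : ℕ), (onBasis K n n fun i => η • bv K n i + bv K n (i - 1))
      = η • same K n n + (1 : K) • down K n n := fun η n => by rw [TwoStep.band_eq, one_smul]
  have hN : ∀ n, down K n n = (0 : K) • same K n n + (1 : K) • down K n n := fun n => by
    rw [zero_smul, one_smul, zero_add]
  have hI : ∀ n, same K n n = (1 : K) • same K n n + (0 : K) • down K n n := fun n => by
    rw [zero_smul, one_smul, add_zero]
  refine ⟨TwoStep.P_tensor_P, TwoStep.tensor_P_of_pi _ _, TwoStep.tensor_P_of_pi _ _,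
    TwoStep.tensor_P_of_pi _ _, TwoStep.tensor_P_of_pi _ _, TwoStep.tensor_P_of_pi _ _,
    TwoStep.M_tensor_M hs, TwoStep.W_tensor_W hs,
    fun h => TwoStep.M_tensor_W_of_le h.le, ?_, TwoStep.M_tensor_W_of_lt,
    TwoStep.M_tensor_commuting (TwoStep.commute_same _) (.inl (TwoStep.bijective_same s)),
    TwoStep.W_tensor_commuting (TwoStep.commute_same _) (.inl (TwoStep.bijective_same s)),
    TwoStep.M_tensor_commuting (TwoStep.commute_same _) (.inl (TwoStep.bijective_same s)),
    TwoStep.M_tensor_commuting (TwoStep.commute_same _).symm (.inr (TwoStep.bijective_same s)),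
    TwoStep.W_tensor_commuting (TwoStep.commute_same _) (.inl (TwoStep.bijective_same s)),
    TwoStep.W_tensor_commuting (TwoStep.commute_same _).symm (.inr (TwoStep.bijective_same s)),
    fun h => ?_, ?_, ?_, ?_, ?_, ?_, ?_⟩
  · rintro rfl
    obtain ⟨e⟩ := TwoStep.M_tensor_W_of_le (K := K) (le_refl r)
    obtain ⟨e'⟩ := TwoStep.minus_W_zero K
    rw [← Nat.sub_self r] at e'
    exact ⟨e.trans ((LinearEquiv.refl _ _).prodCongr e')⟩
  · refine TwoStep.band_tensor_bijective (band η r) ?_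
    rw [band γ s, show γ • same K s s + (1 : K) • down K s s - η • same K s s
      = (γ - η) • same K s s + (1 : K) • down K s s by module]
    exact TwoStep.add_smul_injective (sub_ne_zero.2 h.symm) 1
  · rintro rfl
    exact TwoStep.pencil_tensor (a := 1) (b := 0) (c := η) (d := 1) (X := fun n => same K n n)
      (Y := fun n => onBasis K n n fun i => η • bv K n i + bv K n (i - 1))
      (by simp) hI (band η) hr hs
  · exact TwoStep.pencil_tensor (a := 1) (b := 0) (c := 0) (d := 1) (X := fun n => same K n n)
      (Y := fun n => down K n n) (by simp) hI hN hr hs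
  · exact TwoStep.pencil_tensor (a := 0) (b := 1) (c := 1) (d := 0) (X := fun n => down K n n)
      (Y := fun n => same K n n) (by simp) hN hI hr hs
  · refine TwoStep.band_tensor_bijective (hN r) ?_
    rw [zero_smul, sub_zero]
    exact same_injective le_rfl
  · refine TwoStep.band_tensor_bijective (band η r) ?_
    rw [show down K s s - η • same K s s = (-η) • same K s s + (1 : K) • down K s s by module]
    exact TwoStep.add_smul_injective (neg_ne_zero.2 hη) 1
  · refine TwoStep.band_tensor_bijective (band η r) ?_
    rw [show same K s s - η • down K s s = (1 : K) • same K s s + (-η) • down K s s by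
      module]
    exact TwoStep.add_smul_injective one_ne_zero _
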